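/- **Setting.** Let $d\ge 1$, $p\ge 0$, and let $(\boldsymbol X_t)_{t\in\mathbb Z}$, $\boldsymbol X_t=(X_{t,1},\dots,X_{t,d})\in\mathbb R^d$, be a strictly stationary and absolutely regular time series (its $\beta$-mixing coefficients satisfy $\beta(n)\to0$) with continuous marginal distribution functions $\boldsymbol F=(F_1,\dots,F_d)$. For $\boldsymbol G=(G_1,\dots,G_d)$ write $\boldsymbol G(\boldsymbol x)=(G_1(x_1),\dots,G_d(x_d))$. *Model.* Let $\mathcal V=(V_k,E_k)_k$ be a stationary vine on $\{1,\dots,p+1\}\times\{1,\dots,d\}$: a regular vine (nested trees, $V_{k+1}=E_k$, with the proximity condition) such that for every $m=0,\dots,p$ the restrictions of $\mathcal V$ to the time points $t,\dots,t+m$ are vines, and are translations in time of one vine $\mathcal V^{(m)}$ on $\{1,\dots,m+1\}\times\{1,\dots,d\}$. An edge $e$ has conditioned set $(a_e,b_e)$ and conditioning set $D_e$; edges whose labels are time shifts of each other are equivalent, and $[e]$ is the class of $e$. To every class $[e]$ belongs a parametric family of bivariate copula densities $c_{[e]}(\cdot;\boldsymbol\theta_{[e]})$, with copulas $C_{[e]}$;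 no correct specification is assumed. Let $\boldsymbol\theta=(\boldsymbol\theta_{[e]})_{[e]}\in\Theta\subseteq\mathbb R^q$ be the stacked parameter; derivatives at points of $\Theta$ are assumed to be uniquely determined (e.g. $\Theta$ open, or convex with non-empty interior). For $\boldsymbol u=(\boldsymbol u_1,\dots,\boldsymbol u_{1+p})\in(0,1)^{(p+1)d}$ let $C_{[e],1,\boldsymbol\theta}(\boldsymbol u)=C_{a_e|D_e}(u_{a_e}\mid\boldsymbol u_{D_e})$ and $C_{[e],2,\boldsymbol\theta}(\boldsymbol u)=C_{b_e|D_e}(u_{b_e}\mid\boldsymbol u_{D_e})$, where $e$ is shifted so that its first time point is placed at $\boldsymbol u_1$. These conditional distributions are given by the vine recursion $C_{i}(u_i)=u_i$, and, for an edge $e'$ of the tree below with $a_{e'}=a_e$ and $D_e=D_{e'}\cup\{b_{e'}\}$, $$C_{a_e|D_e}(u_{a_e}\mid\boldsymbol u_{D_e})=\partial_y C_{[e']}(x,y;\boldsymbol\theta_{[e']})\quad\text{at } x=C_{a_{e'}|D_{e'}}(u_{a_{e'}}\mid\boldsymbol u_{D_{e'}}),\ y=C_{b_{e'}|D_{e'}}(u_{b_{e'}}\mid\boldsymbol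 u_{D_{e'}})$$ (and symmetrically with the roles of $a_{e'}$ and $b_{e'}$ exchanged, or for $b_e$). The step-wise score is $$\boldsymbol\phi_{\boldsymbol\theta}(\boldsymbol u)=\Bigl(\nabla_{\boldsymbol\theta_{[e]}}\ln c_{[e]}\bigl\{C_{[e],1,\boldsymbol\theta}(\boldsymbol u),C_{[e],2,\boldsymbol\theta}(\boldsymbol u);\boldsymbol\theta_{[e]}\bigr\}\Bigr)_{[e]},$$ where the two arguments of $c_{[e]}$ are held fixed in the differentiation. *Pseudo-true value.* $\boldsymbol\theta^*\in\Theta$ satisfies $\mathbb E[\boldsymbol\phi_{\boldsymbol\theta^*}\{\boldsymbol F(\boldsymbol X_1),\dots,\boldsymbol F(\boldsymbol X_{1+p})\}]=0$. *Estimator.* Let $\widehat F_j(x)=\frac1{T+1}\sum_{t=1}^T\mathbf 1(X_{t,j}\le x)$ and $\widehat{\boldsymbol F}=(\widehat F_1,\dots,\widehat F_d)$. The semiparametric step-wise estimator $\widehat{\boldsymbol\theta}=\widehat{\boldsymbol\theta}_T$ is any random element which, with probability tending to one as $T\to\infty$, lies in $\Theta$ and solves $$\frac1T\sum_{t=1}^T\boldsymbol\phi_{\boldsymbol\theta}\{\widehat{\boldsymbol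 F}(\boldsymbol X_t),\dots,\widehat{\boldsymbol F}(\boldsymbol X_{t+p})\}=0 .$$ The sequence $(\widehat{\boldsymbol\theta}_T)$ is assumed to be asymptotically tight in $\Theta$: for every $\eta>0$ there is a compact $K\subseteq\Theta$ with $\Pr(\widehat{\boldsymbol\theta}_T\notin K)\le\eta$ for all large $T$ (automatic if $\Theta$ is compact). *Conditions.* For some $\gamma\in[0,1)$ let $w(u)=u^\gamma(1-u)^\gamma$, and for $\delta>0$ let $\mathcal F_\delta$ be the set of all $\boldsymbol G=(G_1,\dots,G_d)$ with $G_j\colon\mathbb R\to[0,1]$ and $|F_j(x)-G_j(x)|\le\delta\,w\{F_j(x)\}$ for all $x$ and $j$. (SP1) $\boldsymbol\theta^*$ lies in the interior of $\Theta$, and for every $\epsilon>0$, $$\inf_{\boldsymbol\theta\in\Theta,\ \|\boldsymbol\theta-\boldsymbol\theta^*\|>\epsilon}\bigl\|\mathbb E[\boldsymbol\phi_{\boldsymbol\theta}\{\boldsymbol F(\boldsymbol X_1),\dots,\boldsymbol F(\boldsymbol X_{1+p})\}]\bigr\|>0.$$ (SP2) The score $\boldsymbol\phi_{\boldsymbol\theta}(\boldsymbol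 u)$ is well defined (the densities are positive at their arguments, and their logarithms differentiable in the parameter) and continuously differentiable in $(\boldsymbol\theta,\boldsymbol u)\in\Theta\times(0,1)^{(p+1)d}$, and there is $\delta>0$ such that for all compact $\tilde\Theta\subseteq\Theta$, all $t=1,\dots,1+p$ and $j=1,\dots,d$, $$\mathbb E\Bigl[\sup_{\boldsymbol\theta\in\tilde\Theta}\sup_{\boldsymbol G\in\mathcal F_\delta}\bigl\{\|\boldsymbol\phi_{\boldsymbol\theta}\{\boldsymbol F(\boldsymbol X_1),\dots,\boldsymbol F(\boldsymbol X_{1+p})\}\|+\|\nabla_{\boldsymbol\theta}\boldsymbol\phi_{\boldsymbol\theta}\{\boldsymbol G(\boldsymbol X_1),\dots,\boldsymbol G(\boldsymbol X_{1+p})\}\|\bigr\}\Bigr]<\infty,$$ $$\mathbb E\Bigl[\sup_{\boldsymbol\theta\in\tilde\Theta}\sup_{\boldsymbol G\in\mathcal F_\delta}\Bigl\|\frac{\partial}{\partial\{G_j(X_{t,j})\}}\boldsymbol\phi_{\boldsymbol\theta}\{\boldsymbol G(\boldsymbol X_1),\dots,\boldsymbol G(\boldsymbol X_{1+p})\}\,w\{F_j(X_{t,j})\}\Bigr\|\Bigr]<\infty,$$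 where the suprema are over those $\boldsymbol G\in\mathcal F_\delta$ for which $\boldsymbol G(\boldsymbol X_1),\dots,\boldsymbol G(\boldsymbol X_{1+p})$ lie in $(0,1)^d$. **Theorem.** Under (SP1) and (SP2), $\widehat{\boldsymbol\theta}_T\to\boldsymbol\theta^*$ in probability as $T\to\infty$. -/

import Mathlib

open MeasureTheory Filter Topology
open scoped ENNReal

noncomputable section

namespace SVine

/-! ### Regular vines

Vertices of the first tree are pairs `(t, j)` of a time index and a variable index. The vertices of
the tree at a higher level are the edges, i.e. the two-element sets of vertices, of the tree below.
Levels are counted from `0`, so that `edges k` are the edges of the `(k+1)`-st tree. -/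

/-- Potential vertices at level `k`: iterated unordered pairs. -/
def Node (ι : Type) : ℕ → Type
  | 0 => ι
  | k + 1 => Sym2 (Node ι k)

/-- A sequence of graphs on the base set `base`, where the vertices of each graph are the edges of
the previous one. -/
structure GraphSeq (ι : Type) where
  base : Finset ι
  edges : (k : ℕ) → Finset (Sym2 (Node ι k))

namespace GraphSeq

variable {ι : Type}

def verts (V : GraphSeq ι) : (k : ℕ) → Finset (Node ι k)
  | 0 => V.base
  | k + 1 => V.edges k

/-- The graph at level `k`. -/
def graph (V : GraphSeq ι) (k : ℕ) : SimpleGraph {v : Node ι k // v ∈ V.verts k} where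
  Adj v w := v ≠ w ∧ s(v.1, w.1) ∈ V.edges k
  symm := ⟨fun v w h => ⟨h.1.symm, by rw [Sym2.eq_swap]; exact h.2⟩⟩
  loopless := ⟨fun _ h => h.1 rfl⟩

/-- Regular vine on `V.base`, a set with `n` elements: `n - 1` nested trees which satisfy the
proximity condition. -/
structure IsRVine (V : GraphSeq ι) : Prop where
  edges_mem : ∀ k < V.base.card - 1, ∀ e ∈ V.edges k, ¬ e.IsDiag ∧ ∀ v ∈ e, v ∈ V.verts k
  isTree : ∀ k < V.base.card - 1, (V.graph k).IsTree
  proximity : ∀ k, k + 1 < V.base.card - 1 → ∀ a b : Sym2 (Node ι k),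
    s(a, b) ∈ V.edges (k + 1) → ∃! v, v ∈ a ∧ v ∈ b

open Classical in
/-- Edges of the restriction to the base set `S`: keep the edges between remaining vertices. -/
def restrictEdges (V : GraphSeq ι) (S : Finset ι) : (k : ℕ) → Finset (Sym2 (Node ι k))
  | 0 => (V.edges 0).filter fun e => ∀ v ∈ e, v ∈ S
  | k + 1 => (V.edges (k + 1)).filter fun e => ∀ v ∈ e, v ∈ V.restrictEdges S k

def restrict (V : GraphSeq ι) (S : Finset ι) : GraphSeq ι where
  base := S
  edges := V.restrictEdges S

/-- The edges of the `n - 1` trees, where `n` is the size of the base set. -/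
def Edge (V : GraphSeq ι) : Type :=
  Σ k : Fin (V.base.card - 1), {e : Sym2 (Node ι k) // e ∈ V.edges k}

instance (V : GraphSeq ι) : Finite V.Edge := by
  unfold Edge; infer_instance

end GraphSeq

/-- Complete union of a vertex or edge. -/
def completeUnion {ι : Type} : (k : ℕ) → Node ι k → Set ι
  | 0, i => {x | x = i}
  | k + 1, e => {x | ∃ v : Node ι k, v ∈ (show Sym2 (Node ι k) from e) ∧ x ∈ completeUnion k v}

/-- Conditioning set `D_e` of an edge: the intersection of the complete unions of its ends. -/
def conditioningSet {ι : Type} {k : ℕ} (e : Sym2 (Node ι k)) : Set ι :=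
  {x | ∀ v ∈ e, x ∈ completeUnion k v}

/-- Conditioned set `{a_e, b_e}` of an edge. -/
def conditionedSet {ι : Type} {k : ℕ} (e : Sym2 (Node ι k)) : Set ι :=
  completeUnion (k + 1) e \ conditioningSet e

/-! ### Translations and stationary vines -/

/-- Vertices `(t, j)`: time index and variable index. -/
abbrev Vtx (d : ℕ) : Type := ℤ × Fin d

def shift {d : ℕ} (τ : ℤ) (x : Vtx d) : Vtx d := (x.1 + τ, x.2)

/-- `e = e' + (τ, 0)`: the labels of `e` are those of `e'`, shifted in time by `τ`. -/
def IsShiftOf {d k k' : ℕ} (τ : ℤ) (e : Sym2 (Node (Vtx d) k)) (e' : Sym2 (Node (Vtx d) k')) :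
    Prop :=
  conditionedSet e = shift τ '' conditionedSet e' ∧
    conditioningSet e = shift τ '' conditioningSet e'

lemma shift_zero_image {d : ℕ} (A : Set (Vtx d)) : shift 0 '' A = A := by
  have : (shift 0 : Vtx d → Vtx d) = id := by funext x; simp [shift]
  rw [this, Set.image_id]

lemma shift_shift_image {d : ℕ} (σ τ : ℤ) (A : Set (Vtx d)) :
    shift σ '' (shift τ '' A) = shift (τ + σ) '' A := by
  rw [Set.image_image]
  congr 1
  funext x
  simp [shift, add_assoc]

/-- The vertices with time index in `{s, …, t}`. -/
def window (d : ℕ) (s t : ℤ) : Finset (Vtx d) := Finset.Icc s t ×ˢ Finset.univ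

/-- `V` is the translation of `W` by `τ`. -/
def IsTranslationOf {d : ℕ} (τ : ℤ) (V W : GraphSeq (Vtx d)) : Prop :=
  ∀ k < V.base.card - 1,
    (∀ e ∈ V.edges k, ∃ e' ∈ W.edges k, IsShiftOf τ e e') ∧
    (∀ e' ∈ W.edges k, ∃ e ∈ V.edges k, IsShiftOf τ e e')

/-- Stationary vine (S-vine) on `{1, …, T} × {1, …, d}`: for every gap `m`, all the restrictions to
time points `t, …, t + m` are vines and are translations of one vine on `{1, …, m + 1}`. -/
structure IsStationaryVine {d : ℕ} (V : GraphSeq (Vtx d)) (T : ℕ) : Prop where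
  base_eq : V.base = window d 1 T
  isRVine : V.IsRVine
  translation : ∀ m < T, ∃ W : GraphSeq (Vtx d), W.base = window d 1 (m + 1) ∧ W.IsRVine ∧
    ∀ t : ℤ, 1 ≤ t → t + m ≤ T →
      (V.restrict (window d t (t + m))).IsRVine ∧
      IsTranslationOf (t - 1) (V.restrict (window d t (t + m))) W

/-- The equivalence relation `e ∼ e'` of being translations of each other. -/
def edgeSetoid {d : ℕ} (V : GraphSeq (Vtx d)) : Setoid V.Edge where
  r e e' := ∃ τ : ℤ, IsShiftOf τ e.2.1 e'.2.1
  iseqv :=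
    { refl := fun e => ⟨0, by simp only [IsShiftOf, shift_zero_image, and_self]⟩
      symm := by
        rintro e e' ⟨τ, h1, h2⟩
        refine ⟨-τ, ?_, ?_⟩
        · rw [h1, shift_shift_image, add_neg_cancel, shift_zero_image]
        · rw [h2, shift_shift_image, add_neg_cancel, shift_zero_image]
      trans := by
        rintro e e' e'' ⟨σ, h1, h2⟩ ⟨τ, h3, h4⟩
        refine ⟨τ + σ, ?_, ?_⟩
        · rw [h1, h3, shift_shift_image]
        · rw [h2, h4, shift_shift_image] }

/-- Equivalence classes `[e]` of edges. -/
def EdgeClass {d : ℕ} (V : GraphSeq (Vtx d)) : Type := Quotient (edgeSetoid V)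

instance {d : ℕ} (V : GraphSeq (Vtx d)) : Finite (EdgeClass V) := by
  unfold EdgeClass; infer_instance

instance {d : ℕ} (V : GraphSeq (Vtx d)) : Fintype (EdgeClass V) := Fintype.ofFinite _

/-! ### Pair-copula families and the score -/

/-- Density of a bivariate copula (only the values on `(0,1)²` matter): nonnegative, with standard
uniform margins. -/
structure IsCopulaDensity (c : ℝ → ℝ → ℝ) : Prop where
  measurable : Measurable (Function.uncurry c)
  nonneg : ∀ x ∈ Set.Ioo (0 : ℝ) 1, ∀ y ∈ Set.Ioo (0 : ℝ) 1, 0 ≤ c x y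
  margin_fst : ∀ᵐ x ∂volume.restrict (Set.Ioo (0 : ℝ) 1), ∫ y in (0 : ℝ)..1, c x y = 1
  margin_snd : ∀ᵐ y ∂volume.restrict (Set.Ioo (0 : ℝ) 1), ∫ x in (0 : ℝ)..1, c x y = 1

/-- The copula `C(x, y) = ∫₀ˣ ∫₀ʸ c` with density `c`. -/
def copulaOf (c : ℝ → ℝ → ℝ) (x y : ℝ) : ℝ := ∫ s in (0 : ℝ)..x, ∫ t in (0 : ℝ)..y, c s t

/-- A parametric family of bivariate functions (the pair-copula densities) for every class of edges;
`density c τ x y` is `c_{[e]}(x, y; τ)`, with a parameter `τ` of dimension `dim c`. -/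
structure PairCopulaModel {d : ℕ} (V : GraphSeq (Vtx d)) where
  dim : EdgeClass V → ℕ
  density : (c : EdgeClass V) → EuclideanSpace ℝ (Fin (dim c)) → ℝ → ℝ → ℝ

open Classical in
/-- The two ends of an edge, ordered such that the variable `a_e` of the first end precedes the
variable `b_e` of the second one (lexicographically: time, then variable). This order is invariant
under translations. -/
def orient {d k : ℕ} (e : Sym2 (Node (Vtx d) k)) : Node (Vtx d) k × Node (Vtx d) k :=
  if ∀ a ∈ completeUnion k (Quot.out e).1 \ completeUnion k (Quot.out e).2,
      ∀ b ∈ completeUnion k (Quot.out e).2 \ completeUnion k (Quot.out e).1, toLex a < toLex b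
  then Quot.out e else (Quot.out e).swap

namespace PairCopulaModel

variable {d : ℕ} {V : GraphSeq (Vtx d)} (M : PairCopulaModel V)

/-- The space of stacked parameter vectors `θ = (θ_{[e]})_{[e]}`, with the Euclidean norm. -/
abbrev Param : Type := EuclideanSpace ℝ (Σ c : EdgeClass V, Fin (M.dim c))

/-- The block `θ_{[e]}` of a stacked parameter vector. -/
def block (θ : M.Param) (c : EdgeClass V) : EuclideanSpace ℝ (Fin (M.dim c)) :=
  WithLp.toLp 2 fun i => θ ⟨c, i⟩

open Classical in
/-- The conditional distribution functions of the vine copula model at `u`. For a vertex `v` at level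
`k` with complete union `{i} ∪ D`, and `A = {i}`, this is `C_{i|D}(u_i | u_D; θ)`. At level `0` it is
`u_i`. If `v` is an edge with label `(a, b | D')`, then it is
`∂/∂y C_{[v]}(x, y)` if `i = a` and `∂/∂x C_{[v]}(x, y)` if `i = b`, evaluated at
`x = C_{a|D'}(u_a | u_D'; θ)` and `y = C_{b|D'}(u_b | u_D'; θ)`. -/
def condDist (θ : M.Param) (u : Vtx d → ℝ) : (k : ℕ) → Node (Vtx d) k → Set (Vtx d) → ℝ
  | 0, i, _ => u i
  | k + 1, e, A =>
    if h : ∃ hk : k < V.base.card - 1, e ∈ V.edges k then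
      let c : EdgeClass V := Quotient.mk (edgeSetoid V) ⟨⟨k, h.1⟩, ⟨e, h.2⟩⟩
      let v := (orient (k := k) e).1
      let w := (orient (k := k) e).2
      let a := completeUnion k v \ completeUnion k w
      let b := completeUnion k w \ completeUnion k v
      let x := condDist θ u k v a
      let y := condDist θ u k w b
      if A = a then deriv (fun y' => copulaOf (M.density c (M.block θ c)) x y') y
      else deriv (fun x' => copulaOf (M.density c (M.block θ c)) x' y) x
    else 0

/-- A representative of the class `[e]`. -/
def rep (c : EdgeClass V) : V.Edge := Quotient.out c

/-- The first time point which occurs in the complete union of the representative. -/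
def startTime (c : EdgeClass V) : ℤ :=
  sInf (Prod.fst '' completeUnion ((rep c).1 + 1) (rep c).2.1)

/-- Place the window `(u_1, …, u_{1+p})` at time points `s, …, s + p`. -/
def placeAt {d p : ℕ} (s : ℤ) (u : Fin (p + 1) → Fin d → ℝ) (x : Vtx d) : ℝ :=
  if h : (x.1 - s).toNat < p + 1 ∧ s ≤ x.1 then u ⟨(x.1 - s).toNat, h.1⟩ x.2 else 0

/-- `C_{[e], 1, θ}(u_1, …, u_{1+p}) = C_{a|D}(u_a | u_D; θ)`. -/
def arg₁ {p : ℕ} (θ : M.Param) (c : EdgeClass V) (u : Fin (p + 1) → Fin d → ℝ) : ℝ :=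
  M.condDist θ (placeAt (startTime c) u) (rep c).1 (orient (rep c).2.1).1
    (completeUnion _ (orient (rep c).2.1).1 \ completeUnion _ (orient (rep c).2.1).2)

/-- `C_{[e], 2, θ}(u_1, …, u_{1+p}) = C_{b|D}(u_b | u_D; θ)`. -/
def arg₂ {p : ℕ} (θ : M.Param) (c : EdgeClass V) (u : Fin (p + 1) → Fin d → ℝ) : ℝ :=
  M.condDist θ (placeAt (startTime c) u) (rep c).1 (orient (rep c).2.1).2
    (completeUnion _ (orient (rep c).2.1).2 \ completeUnion _ (orient (rep c).2.1).1)

/-- `ln c_{[e]}(C_{[e],1,θ}(u), C_{[e],2,θ}(u); θ'_{[e]})`. -/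
def logDensity {p : ℕ} (θ : M.Param) (c : EdgeClass V) (u : Fin (p + 1) → Fin d → ℝ)
    (θ' : M.Param) : ℝ :=
  Real.log (M.density c (M.block θ' c) (M.arg₁ θ c u) (M.arg₂ θ c u))

/-- The stacked score `φ_θ(u) = (∇_{θ_{[e]}} ln c_{[e]}(C_{[e],1,θ}(u), C_{[e],2,θ}(u); θ_{[e]}))_{[e]}`,
where the arguments `C_{[e],1,θ}(u)`, `C_{[e],2,θ}(u)` are held fixed in the differentiation. -/
def score {p : ℕ} (Θ : Set M.Param) (θ : M.Param) (u : Fin (p + 1) → Fin d → ℝ) : M.Param :=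
  WithLp.toLp 2 fun ci => gradientWithin (M.logDensity θ ci.1 u) Θ θ ci

end PairCopulaModel

/-! ### Time series -/

section TimeSeries

variable {Ω : Type*} [MeasurableSpace Ω] {d : ℕ}

/-- Strict stationarity: the law of the whole series is invariant under a time shift. -/
def StrictlyStationary (X : ℤ → Ω → Fin d → ℝ) (μ : Measure Ω) : Prop :=
  μ.map (fun ω (t : ℤ) => X (t + 1) ω) = μ.map (fun ω (t : ℤ) => X t ω)

def past (X : ℤ → Ω → Fin d → ℝ) (ω : Ω) : Set.Iic (0 : ℤ) → Fin d → ℝ := fun s => X s ω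

def future (X : ℤ → Ω → Fin d → ℝ) (n : ℕ) (ω : Ω) : Set.Ici (n : ℤ) → Fin d → ℝ := fun s => X s ω

/-- The `β`-mixing coefficient of a strictly stationary series: total variation distance between the
joint law of `(X_s)_{s ≤ 0}` and `(X_s)_{s ≥ n}` and the product of their laws. -/
def betaMixing (X : ℤ → Ω → Fin d → ℝ) (μ : Measure Ω) (n : ℕ) : ℝ :=
  ⨆ A : {A : Set ((Set.Iic (0 : ℤ) → Fin d → ℝ) × (Set.Ici (n : ℤ) → Fin d → ℝ)) //
      MeasurableSet A},
    |(μ.map fun ω => (past X ω, future X n ω)).real A.1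
      - ((μ.map (past X)).prod (μ.map (future X n))).real A.1|

def AbsolutelyRegular (X : ℤ → Ω → Fin d → ℝ) (μ : Measure Ω) : Prop :=
  Tendsto (betaMixing X μ) atTop (𝓝 0)

/-- The window `(X_t, …, X_{t+p})`. -/
def dataWindow (p : ℕ) (X : ℤ → Ω → Fin d → ℝ) (t : ℤ) (ω : Ω) : Fin (p + 1) → Fin d → ℝ :=
  fun k => X (t + k) ω

/-- The stationary marginal distribution functions `F_1, …, F_d`. -/
def margin (X : ℤ → Ω → Fin d → ℝ) (μ : Measure Ω) (j : Fin d) (z : ℝ) : ℝ :=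
  μ.real {ω | X 1 ω j ≤ z}

open Classical in
/-- The rescaled empirical distribution functions of `X_1, …, X_T`. -/
def empMargin (X : ℤ → Ω → Fin d → ℝ) (T : ℕ) (ω : Ω) (j : Fin d) (z : ℝ) : ℝ :=
  (∑ t ∈ Finset.Icc (1 : ℤ) T, if X t ω j ≤ z then (1 : ℝ) else 0) / (T + 1)

end TimeSeries

/-! ### Regularity conditions -/

/-- `(G(x_1), …, G(x_{1+p}))`, where `G(x) = (G_1(x_1), …, G_d(x_d))`. -/
def applyMargins {d p : ℕ} (G : Fin d → ℝ → ℝ) (x : Fin (p + 1) → Fin d → ℝ) :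
    Fin (p + 1) → Fin d → ℝ :=
  fun t j => G j (x t j)

/-- The open unit cube `(0,1)^{(p+1)d}`. -/
def openCube (d p : ℕ) : Set (Fin (p + 1) → Fin d → ℝ) := {u | ∀ t j, u t j ∈ Set.Ioo (0 : ℝ) 1}

/-- The weight function `w(u) = u^γ (1 - u)^γ`. -/
def weight (γ u : ℝ) : ℝ := u ^ γ * (1 - u) ^ γ

/-- The neighbourhood `𝓕_δ` of the margins `F`. -/
def marginNhd {d : ℕ} (γ δ : ℝ) (F : Fin d → ℝ → ℝ) : Set (Fin d → ℝ → ℝ) :=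
  {G | ∀ j z, G j z ∈ Set.Icc (0 : ℝ) 1 ∧ |F j z - G j z| ≤ δ * weight γ (F j z)}

/-- `E f < ∞`, for a nonnegative `f` whose measurability is not presupposed: `f` has an integrable
majorant. For measurable `f` this says `∫⁻ f < ∞`. -/
def FiniteMean {E : Type*} [MeasurableSpace E] (P : Measure E) (f : E → ℝ≥0∞) : Prop :=
  ∃ h : E → ℝ≥0∞, Measurable h ∧ f ≤ᵐ[P] h ∧ ∫⁻ x, h x ∂P < ∞

/-- The expected score `E φ_θ(F(X_1), …, F(X_{1+p}))`; `P` is the law of `(X_1, …, X_{1+p})`. -/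
def meanScore {d p : ℕ} {V : GraphSeq (Vtx d)} (M : PairCopulaModel V) (Θ : Set M.Param)
    (P : Measure (Fin (p + 1) → Fin d → ℝ)) (F : Fin d → ℝ → ℝ) (θ : M.Param) : M.Param :=
  ∫ x, M.score Θ θ (applyMargins F x) ∂P

/-- Identifiability: `θ*` is an interior point of `Θ`, and the expected score is bounded away from
zero outside of every ball around `θ*`. -/
structure Identifiable {d p : ℕ} {V : GraphSeq (Vtx d)} (M : PairCopulaModel V) (Θ : Set M.Param)
    (P : Measure (Fin (p + 1) → Fin d → ℝ)) (F : Fin d → ℝ → ℝ) (θs : M.Param) : Prop where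
  interior : θs ∈ interior Θ
  separated : ∀ ε > 0, ∃ η > 0, ∀ θ ∈ Θ, ε < ‖θ - θs‖ → η ≤ ‖meanScore M Θ P F θ‖

/-- Smoothness and moments of the score. The score is a function on `Θ × (0,1)^{(p+1)d}`, so that the
suprema are over those `G ∈ 𝓕_δ` for which `(G(x_1), …, G(x_{1+p}))` is in the open cube. -/
structure RegularScore {d p : ℕ} {V : GraphSeq (Vtx d)} (M : PairCopulaModel V) (Θ : Set M.Param)
    (P : Measure (Fin (p + 1) → Fin d → ℝ)) (F : Fin d → ℝ → ℝ) (γ : ℝ) : Prop where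
  /-- The gradient of the log-density, which makes up the score, exists. -/
  density_pos : ∀ θ ∈ Θ, ∀ u ∈ openCube d p, ∀ c,
    0 < M.density c (M.block θ c) (M.arg₁ θ c u) (M.arg₂ θ c u)
  logDensity_diff : ∀ θ ∈ Θ, ∀ u ∈ openCube d p, ∀ c,
    DifferentiableWithinAt ℝ (M.logDensity θ c u) Θ θ
  contDiff : ContDiffOn ℝ 1
    (fun z : M.Param × (Fin (p + 1) → Fin d → ℝ) => M.score Θ z.1 z.2) (Θ ×ˢ openCube d p)
  moments : ∃ δ > 0, ∀ K : Set M.Param, IsCompact K → K ⊆ Θ →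
    FiniteMean P (fun x => ⨆ θ ∈ K, ⨆ G ∈ marginNhd γ δ F, ⨆ _ : applyMargins G x ∈ openCube d p,
      (‖M.score Θ θ (applyMargins F x)‖ₑ
        + ‖fderivWithin ℝ (fun θ' => M.score Θ θ' (applyMargins G x)) Θ θ‖ₑ)) ∧
    ∀ (t : Fin (p + 1)) (j : Fin d),
      FiniteMean P (fun x => ⨆ θ ∈ K, ⨆ G ∈ marginNhd γ δ F,
        ⨆ _ : applyMargins G x ∈ openCube d p,
          ‖weight γ (F j (x t j)) •
            fderiv ℝ (M.score Θ θ) (applyMargins G x) (Pi.single t (Pi.single j 1))‖ₑ)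

/-- `θ ∈ Θ` solves the estimating equation of the semiparametric step-wise estimator. -/
def SolvesEstimatingEq {Ω : Type*} {d : ℕ} (p : ℕ) {V : GraphSeq (Vtx d)}
    (M : PairCopulaModel V) (Θ : Set M.Param) (X : ℤ → Ω → Fin d → ℝ) (T : ℕ) (ω : Ω)
    (θ : M.Param) : Prop :=
  θ ∈ Θ ∧ (1 / (T : ℝ)) • ∑ t ∈ Finset.Icc (1 : ℤ) T,
    M.score Θ θ (applyMargins (empMargin X T ω) (dataWindow p X t ω)) = 0

end SVine

end

/-!
The score enters only as a `C¹` function of the parameter and of a point of the open cube, with the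
integrable majorants of `RegularScore`; the vine recursion behind it plays no role. By tightness, and
since the expected score is bounded away from zero outside of neighbourhoods of `θs`, it suffices that
on every compact set `K ⊆ Θ` the estimating function converges to the expected score, uniformly and
in probability. The error has two parts.

*Uniform law of large numbers, with the true margins.* A weak law of large numbers in `L¹` is proved
for functions with values in a Banach space (`PairwiseMixing.tendsto_lintegral_meanDev`): for
indicator functions it is a variance bound by Cesàro means of the mixing coefficients, and
the functions for which it holds form a closed subspace of `L¹`. For the Banach space `C(K, E)`
it is the uniform law of large numbers, because a dominated random continuous function on `K` is an
integrable random element of that space (`exists_integrable_continuousMap`).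

*Replacing the true margins `F` by the empirical ones.* By the mean value inequality
(`norm_sub_le_of_margins`) the difference of the scores at a window is at most `δ'` times an integrable
function of the window, if the empirical margins are within `δ'` times the weight `w(F)` of the true
ones. For `γ > 0` the margins `F̂` are not in the neighbourhood `𝓕_δ`, since `F̂ ≤ T / (T + 1)` and `w(F)`
vanishes at the upper end; but only the values at the sample points matter. There the bound
holds for every `δ' > 0` with probability tending to one
(`PairwiseMixing.tendsto_measureReal_weighted`): in the middle by the Glivenko–Cantelli
theorem; in the tails `v^{-γ}` times the empirical distribution function at `v ≤ a` is at most the sample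
mean of `u^{-γ} 1(u ≤ a)`, whose expectation is small because `γ < 1`; and the error `1 / (T + 1)` of
the rescaling is negligible since the largest of `T` uniform variables is at distance of order `1 / T`
from `1`, and `T^{-1}` is of smaller order than `T^{-γ}`. The windows also contain the `p` observations
after time `T`, where `F̂` may vanish, but with probability tending to zero.
-/

namespace SVine

/-! ### The weak law of large numbers for mixing sequences -/

section MixingLLN

variable {Ω 𝒴 : Type*} [MeasurableSpace Ω] [MeasurableSpace 𝒴]

/-- A sequence `Y` with common law `P` whose pairwise dependence is controlled by a null sequence
`b` of the lag. Bounds for joint probabilities of the same event at two times suffice for laws of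
large numbers. -/
structure PairwiseMixing (Y : ℕ → Ω → 𝒴) (μ : Measure Ω) (P : Measure 𝒴) (b : ℕ → ℝ) : Prop where
  measurable : ∀ t, Measurable (Y t)
  map_eq : ∀ t, μ.map (Y t) = P
  tendsto : Tendsto b atTop (𝓝 0)
  cov_le : ∀ s t, s ≤ t → ∀ A, MeasurableSet A →
    |μ.real (Y s ⁻¹' A ∩ Y t ⁻¹' A) - P.real A ^ 2| ≤ b (t - s)

/-- Deviation of the sample mean of `g (Y t)`, `t < T`, from the mean of `g` under `P`. -/
noncomputable def meanDev {B : Type*} [NormedAddCommGroup B] [NormedSpace ℝ B]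
    (Y : ℕ → Ω → 𝒴) (P : Measure 𝒴) (g : 𝒴 → B) (T : ℕ) (ω : Ω) : B :=
  (T : ℝ)⁻¹ • ∑ t ∈ Finset.range T, g (Y t ω) - ∫ y, g y ∂P

namespace PairwiseMixing

variable {Y : ℕ → Ω → 𝒴} {μ : Measure Ω} {P : Measure 𝒴} {b : ℕ → ℝ}

lemma nonneg (h : PairwiseMixing Y μ P b) (n : ℕ) : 0 ≤ b n := by
  simpa using (abs_nonneg _).trans (h.cov_le 0 n n.zero_le ∅ .empty)

lemma isProbabilityMeasure [IsProbabilityMeasure μ] (h : PairwiseMixing Y μ P b) :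
    IsProbabilityMeasure P := by
  rw [← h.map_eq 0]
  exact Measure.isProbabilityMeasure_map (h.measurable 0).aemeasurable

/-- Every lag occurs at most `T` times among the pairs `s ≤ t < T`. -/
lemma sum_lag_le (h : PairwiseMixing Y μ P b) (T : ℕ) :
    ∑ s ∈ Finset.range T, ∑ t ∈ Finset.range T, (if s ≤ t then b (t - s) else 0)
      ≤ T * ∑ n ∈ Finset.range T, b n := by
  calc _ ≤ ∑ s ∈ Finset.range T, ∑ n ∈ Finset.range T, b n := by
        refine Finset.sum_le_sum fun s _ => ?_
        rw [← Finset.sum_filter]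
        have : (Finset.range T).filter (fun t => s ≤ t) = Finset.Ico s T := by
          ext t; simp [and_comm]
        rw [this, Finset.sum_Ico_eq_sum_range]
        simp only [add_tsub_cancel_left]
        exact Finset.sum_le_sum_of_subset_of_nonneg
          (Finset.range_subset_range.2 (Nat.sub_le _ _)) fun n _ _ => h.nonneg n
    _ = _ := by simp

lemma integral_mul_le [IsProbabilityMeasure μ] (h : PairwiseMixing Y μ P b) {A : Set 𝒴}
    (hA : MeasurableSet A) {s t : ℕ} (hst : s ≤ t) :
    ∫ ω, ((Y s ⁻¹' A).indicator 1 ω - P.real A) * ((Y t ⁻¹' A).indicator 1 ω - P.real A) ∂μ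
      ≤ b (t - s) := by
  have hm : ∀ t, MeasurableSet (Y t ⁻¹' A) := fun t => h.measurable t hA
  have hr : ∀ t, μ.real (Y t ⁻¹' A) = P.real A := fun t => by
    rw [← h.map_eq t, map_measureReal_apply (h.measurable t) hA]
  have hi : ∀ {S : Set Ω}, MeasurableSet S → Integrable (S.indicator (1 : Ω → ℝ)) μ :=
    fun hS => (integrable_const (1 : ℝ)).indicator hS
  have e : ∀ ω, ((Y s ⁻¹' A).indicator 1 ω - P.real A) * ((Y t ⁻¹' A).indicator 1 ω - P.real A)
      = (Y s ⁻¹' A ∩ Y t ⁻¹' A).indicator (1 : Ω → ℝ) ω - P.real A * (Y s ⁻¹' A).indicator 1 ω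
        - P.real A * (Y t ⁻¹' A).indicator 1 ω + P.real A ^ 2 := by
    intro ω
    rw [Set.inter_indicator_one, Pi.mul_apply]
    ring
  simp_rw [e]
  have i₁ : Integrable (fun ω => (Y s ⁻¹' A ∩ Y t ⁻¹' A).indicator (1 : Ω → ℝ) ω) μ :=
    hi ((hm s).inter (hm t))
  have i₂ : ∀ r, Integrable (fun ω => P.real A * (Y r ⁻¹' A).indicator (1 : Ω → ℝ) ω) μ :=
    fun r => (hi (hm r)).const_mul _
  have i₃ : Integrable (fun ω => (Y s ⁻¹' A ∩ Y t ⁻¹' A).indicator (1 : Ω → ℝ) ω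
      - P.real A * (Y s ⁻¹' A).indicator (1 : Ω → ℝ) ω) μ := i₁.sub (i₂ s)
  have i₄ : Integrable (fun ω => (Y s ⁻¹' A ∩ Y t ⁻¹' A).indicator (1 : Ω → ℝ) ω
      - P.real A * (Y s ⁻¹' A).indicator (1 : Ω → ℝ) ω
      - P.real A * (Y t ⁻¹' A).indicator (1 : Ω → ℝ) ω) μ := i₃.sub (i₂ t)
  rw [integral_add i₄ (integrable_const _), integral_sub i₃ (i₂ t), integral_sub i₁ (i₂ s),
    integral_const_mul, integral_const_mul, integral_indicator_one ((hm s).inter (hm t)),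
    integral_indicator_one (hm s), integral_indicator_one (hm t), hr, hr]
  have := (abs_le.1 (h.cov_le s t hst A hA)).2
  simp only [integral_const, probReal_univ, one_smul]
  linarith

lemma integral_sq_meanDev_indicator_le [IsProbabilityMeasure μ] (h : PairwiseMixing Y μ P b)
    {A : Set 𝒴} (hA : MeasurableSet A) {T : ℕ} (hT : 0 < T) :
    ∫ ω, meanDev Y P (A.indicator (1 : 𝒴 → ℝ)) T ω ^ 2 ∂μ
      ≤ 2 * ((T : ℝ)⁻¹ * ∑ n ∈ Finset.range T, b n) := by
  have hT' : (0 : ℝ) < T := by exact_mod_cast hT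
  set D : ℕ → Ω → ℝ := fun t ω => (Y t ⁻¹' A).indicator 1 ω - P.real A with hD
  have hint : ∀ s t, Integrable (fun ω => D s ω * D t ω) μ := by
    intro s t
    have hb : ∀ t ω, ‖D t ω‖ ≤ 1 := by
      intro t ω
      have h0 : 0 ≤ P.real A := measureReal_nonneg
      have := h.isProbabilityMeasure
      have h1 : P.real A ≤ 1 := measureReal_le_one
      simp only [hD, Set.indicator, Real.norm_eq_abs, Pi.one_apply]
      split_ifs <;> rw [abs_le] <;> constructor <;> linarith
    have hmD : ∀ t, Measurable (D t) := fun t =>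
      (measurable_one.indicator (h.measurable t hA)).sub_const _
    refine Integrable.of_bound ((hmD s).mul (hmD t)).aestronglyMeasurable 1 (ae_of_all _ fun ω => ?_)
    rw [norm_mul]
    exact mul_le_one₀ (hb s ω) (norm_nonneg _) (hb t ω)
  have e : ∀ ω, meanDev Y P (A.indicator (1 : 𝒴 → ℝ)) T ω ^ 2
      = (T : ℝ)⁻¹ ^ 2 * ∑ s ∈ Finset.range T, ∑ t ∈ Finset.range T, D s ω * D t ω := by
    intro ω
    rw [← Finset.sum_mul_sum, ← sq, ← mul_pow]
    congr 1
    simp only [meanDev, integral_indicator_one hA, hD, Finset.sum_sub_distrib, Finset.sum_const,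
      Finset.card_range, smul_eq_mul, nsmul_eq_mul, mul_sub]
    rw [inv_mul_cancel_left₀ hT'.ne']
    rfl
  simp_rw [e]
  rw [integral_const_mul, integral_finsetSum _ fun s _ => integrable_finsetSum _ fun t _ => hint s t]
  simp_rw [integral_finsetSum _ fun t _ => hint _ t]
  have hle : ∀ s t, ∫ ω, D s ω * D t ω ∂μ
      ≤ (if s ≤ t then b (t - s) else 0) + (if t ≤ s then b (s - t) else 0) := by
    intro s t
    have key := fun {s t : ℕ} (hst : s ≤ t) => h.integral_mul_le hA hst
    rcases le_total s t with hst | hst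
    · rw [if_pos hst]
      have : 0 ≤ (if t ≤ s then b (s - t) else 0) := by split_ifs <;> simp [h.nonneg]
      exact (key hst).trans (by linarith)
    · rw [if_pos hst]
      have : 0 ≤ (if s ≤ t then b (t - s) else 0) := by split_ifs <;> simp [h.nonneg]
      simp_rw [mul_comm (D s _)]
      exact (key hst).trans (by linarith)
  calc (T : ℝ)⁻¹ ^ 2 * ∑ s ∈ Finset.range T, ∑ t ∈ Finset.range T, ∫ ω, D s ω * D t ω ∂μ
      ≤ (T : ℝ)⁻¹ ^ 2 * ∑ s ∈ Finset.range T, ∑ t ∈ Finset.range T,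
          ((if s ≤ t then b (t - s) else 0) + (if t ≤ s then b (s - t) else 0)) := by
        gcongr with s _ t _
        exact hle s t
    _ = (T : ℝ)⁻¹ ^ 2 * (2 * ∑ s ∈ Finset.range T, ∑ t ∈ Finset.range T,
          (if s ≤ t then b (t - s) else 0)) := by
        simp_rw [Finset.sum_add_distrib]
        rw [Finset.sum_comm (f := fun s t => if t ≤ s then b (s - t) else 0)]
        ring
    _ ≤ (T : ℝ)⁻¹ ^ 2 * (2 * (T * ∑ n ∈ Finset.range T, b n)) := by
        gcongr
        exact h.sum_lag_le T
    _ = _ := by field_simp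

lemma tendsto_integral_sq_indicator [IsProbabilityMeasure μ] (h : PairwiseMixing Y μ P b)
    {A : Set 𝒴} (hA : MeasurableSet A) :
    Tendsto (fun T => ∫ ω, meanDev Y P (A.indicator (1 : 𝒴 → ℝ)) T ω ^ 2 ∂μ) atTop (𝓝 0) := by
  refine squeeze_zero' (.of_forall fun T => integral_nonneg fun ω => sq_nonneg _) ?_
    (by simpa using h.tendsto.cesaro.const_mul 2)
  filter_upwards [eventually_gt_atTop 0] with T hT
  exact h.integral_sq_meanDev_indicator_le hA hT

lemma aestronglyMeasurable_comp (h : PairwiseMixing Y μ P b) {B : Type*}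
    [TopologicalSpace B] {g : 𝒴 → B}
    (hg : AEStronglyMeasurable g P) (t : ℕ) : AEStronglyMeasurable (fun ω => g (Y t ω)) μ := by
  rw [← h.map_eq t] at hg
  exact hg.comp_measurable (h.measurable t)

variable {B : Type*} [NormedAddCommGroup B] [NormedSpace ℝ B]

lemma aestronglyMeasurable_meanDev (h : PairwiseMixing Y μ P b) {g : 𝒴 → B}
    (hg : AEStronglyMeasurable g P) (T : ℕ) : AEStronglyMeasurable (meanDev Y P g T) μ :=
  ((Finset.aestronglyMeasurable_fun_sum _ fun t _ =>
    h.aestronglyMeasurable_comp hg t).const_smul _).sub aestronglyMeasurable_const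

lemma tendsto_lintegral_meanDev_indicator_one [IsProbabilityMeasure μ]
    (h : PairwiseMixing Y μ P b) {A : Set 𝒴} (hA : MeasurableSet A) :
    Tendsto (fun T => ∫⁻ ω, ‖meanDev Y P (A.indicator (1 : 𝒴 → ℝ)) T ω‖ₑ ∂μ) atTop (𝓝 0) := by
  have hL2 := h.tendsto_integral_sq_indicator hA
  have := h.isProbabilityMeasure
  have hbd : ∀ T ω, ‖meanDev Y P (A.indicator (1 : 𝒴 → ℝ)) T ω‖
      ≤ |(T : ℝ)⁻¹| * T + 1 := by
    intro T ω
    refine (norm_sub_le _ _).trans (add_le_add ?_ ?_)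
    · rw [norm_smul, Real.norm_eq_abs]
      gcongr
      refine (norm_sum_le _ _).trans ?_
      refine (Finset.sum_le_card_nsmul _ _ 1 fun t _ => ?_).trans (by simp)
      refine (norm_indicator_le_norm_self _ _).trans (by simp)
    · rw [integral_indicator_one hA, Real.norm_eq_abs, abs_of_nonneg measureReal_nonneg]
      exact measureReal_le_one
  have hmem : ∀ T, MemLp (meanDev Y P (A.indicator (1 : 𝒴 → ℝ)) T) 2 μ := fun T =>
    MemLp.of_bound (h.aestronglyMeasurable_meanDev
      (measurable_one.indicator hA).aestronglyMeasurable T) _ (ae_of_all _ (hbd T))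
  have hsqrt := hL2.sqrt
  rw [Real.sqrt_zero] at hsqrt
  have hof := ENNReal.tendsto_ofReal hsqrt
  rw [ENNReal.ofReal_zero] at hof
  refine tendsto_of_tendsto_of_tendsto_of_le_of_le tendsto_const_nhds hof
    (fun _ => zero_le) fun T => ?_
  have := ProbabilityTheory.variance_eq_sub (hmem T).norm
  have h0 := ProbabilityTheory.variance_nonneg (fun ω => ‖meanDev Y P (A.indicator (1 : 𝒴 → ℝ)) T ω‖) μ
  rw [this] at h0
  change _ ≤ ENNReal.ofReal _
  rw [← ofReal_integral_norm_eq_lintegral_enorm ((hmem T).integrable (by norm_num))]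
  refine ENNReal.ofReal_le_ofReal (Real.le_sqrt_of_sq_le ?_)
  simp only [Pi.pow_apply, Real.norm_eq_abs, sq_abs] at h0 ⊢
  linarith

/-- The map from `g` to the deviation of its sample mean is bounded in `L¹`, uniformly in `T`. -/
lemma lintegral_meanDev_le [IsProbabilityMeasure μ] (h : PairwiseMixing Y μ P b) (g : 𝒴 → B)
    (hg : AEStronglyMeasurable g P) (T : ℕ) :
    ∫⁻ ω, ‖meanDev Y P g T ω‖ₑ ∂μ ≤ 2 * ∫⁻ y, ‖g y‖ₑ ∂P := by
  have := h.isProbabilityMeasure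
  have h1 : ∀ t, ∫⁻ ω, ‖g (Y t ω)‖ₑ ∂μ = ∫⁻ y, ‖g y‖ₑ ∂P := fun t => by
    rw [← h.map_eq t, lintegral_map' _ (h.measurable t).aemeasurable]
    rw [h.map_eq t]; exact hg.enorm
  have hm := fun t => (h.aestronglyMeasurable_comp hg t).enorm
  calc ∫⁻ ω, ‖meanDev Y P g T ω‖ₑ ∂μ
      ≤ ∫⁻ ω, (‖(T : ℝ)⁻¹‖ₑ * ∑ t ∈ Finset.range T, ‖g (Y t ω)‖ₑ) + ∫⁻ y, ‖g y‖ₑ ∂P ∂μ := by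
        refine lintegral_mono fun ω => (enorm_sub_le).trans (add_le_add ?_ ?_)
        · rw [enorm_smul]
          gcongr
          exact enorm_sum_le _ _
        · exact enorm_integral_le_lintegral_enorm _
    _ = ‖(T : ℝ)⁻¹‖ₑ * (T * ∫⁻ y, ‖g y‖ₑ ∂P) + ∫⁻ y, ‖g y‖ₑ ∂P := by
        rw [lintegral_add_right _ measurable_const, lintegral_const_mul'' _
          (Finset.aemeasurable_fun_sum _ fun t _ => hm t), lintegral_finsetSum' _ fun t _ => hm t]
        simp [h1]
    _ ≤ 2 * ∫⁻ y, ‖g y‖ₑ ∂P := by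
        rw [two_mul, ← mul_assoc]
        gcongr
        refine mul_le_of_le_one_left (zero_le) ?_
        rcases T.eq_zero_or_pos with rfl | hT
        · simp
        · rw [enorm_inv (by positivity), Real.enorm_natCast, ENNReal.inv_mul_cancel] <;> simp [hT.ne']

/-- Weak law of large numbers in `L¹` for Banach-space valued functions of a mixing sequence. -/
theorem tendsto_lintegral_meanDev [CompleteSpace B] [IsProbabilityMeasure μ]
    (h : PairwiseMixing Y μ P b) {g : 𝒴 → B} (hg : Integrable g P) :
    Tendsto (fun T => ∫⁻ ω, ‖meanDev Y P g T ω‖ₑ ∂μ) atTop (𝓝 0) := by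
  have := h.isProbabilityMeasure
  have hsub : ∀ f g : 𝒴 → B, Integrable f P → Integrable g P → ∀ T ω,
      meanDev Y P (f - g) T ω = meanDev Y P f T ω - meanDev Y P g T ω := by
    intro f g hf hg T ω
    simp only [meanDev, Pi.sub_apply, integral_sub hf hg, Finset.sum_sub_distrib, smul_sub]
    abel
  -- the functions for which the law holds are closed under approximation in `L¹`
  have happrox : ∀ g : 𝒴 → B, Integrable g P →
      (∀ ε : ℝ≥0∞, 0 < ε → ∃ f : 𝒴 → B, Integrable f P ∧ ∫⁻ y, ‖(g - f) y‖ₑ ∂P ≤ ε ∧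
        Tendsto (fun T => ∫⁻ ω, ‖meanDev Y P f T ω‖ₑ ∂μ) atTop (𝓝 0)) →
      Tendsto (fun T => ∫⁻ ω, ‖meanDev Y P g T ω‖ₑ ∂μ) atTop (𝓝 0) := by
    intro g hg H
    rw [ENNReal.tendsto_nhds_zero]
    intro ε hε
    obtain ⟨f, hf, hfg, hlim⟩ := H (ε / 4) (ENNReal.div_pos hε.ne' (by norm_num))
    have h2 := (ENNReal.tendsto_nhds_zero.1 hlim) (ε / 2) (ENNReal.div_pos hε.ne' (by norm_num))
    filter_upwards [h2] with T hT
    have hm := (h.aestronglyMeasurable_meanDev hf.1 T).enorm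
    calc ∫⁻ ω, ‖meanDev Y P g T ω‖ₑ ∂μ
        ≤ ∫⁻ ω, ‖meanDev Y P (g - f) T ω‖ₑ + ‖meanDev Y P f T ω‖ₑ ∂μ := by
          refine lintegral_mono fun ω => ?_
          have : meanDev Y P g T ω = meanDev Y P (g - f) T ω + meanDev Y P f T ω := by
            rw [hsub g f hg hf]; abel
          rw [this]
          exact enorm_add_le _ _
      _ = ∫⁻ ω, ‖meanDev Y P (g - f) T ω‖ₑ ∂μ + ∫⁻ ω, ‖meanDev Y P f T ω‖ₑ ∂μ :=
          lintegral_add_right' _ hm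
      _ ≤ 2 * (ε / 4) + ε / 2 := by
          gcongr
          exact (h.lintegral_meanDev_le _ (hg.sub hf).1 T).trans (by gcongr)
      _ = ε := by
          rw [show (4 : ℝ≥0∞) = 2 * 2 by norm_num, ENNReal.div_eq_inv_mul,
            ENNReal.mul_inv (by simp) (by simp), mul_assoc, ← mul_assoc 2,
            ENNReal.mul_inv_cancel (by simp) (by simp), one_mul, ← ENNReal.div_eq_inv_mul,
            ENNReal.add_halves]
  refine Integrable.induction (P := fun g : 𝒴 → B =>
    Tendsto (fun T => ∫⁻ ω, ‖meanDev Y P g T ω‖ₑ ∂μ) atTop (𝓝 0)) ?_ ?_ ?_ ?_ hg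
  · intro c A hA _
    have e : ∀ T ω, meanDev Y P (A.indicator fun _ => c) T ω
        = meanDev Y P (A.indicator (1 : 𝒴 → ℝ)) T ω • c := by
      intro T ω
      have : ∀ y, A.indicator (fun _ => c) y = A.indicator (1 : 𝒴 → ℝ) y • c := fun y => by
        by_cases hy : y ∈ A <;> simp [hy]
      simp only [meanDev, this]
      rw [sub_smul, smul_assoc, Finset.sum_smul, integral_smul_const]
    simp_rw [e, enorm_smul]
    have := ENNReal.Tendsto.mul_const (b := ‖c‖ₑ) (h.tendsto_lintegral_meanDev_indicator_one hA)
      (Or.inr (by simp))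
    simp_rw [lintegral_mul_const' _ _ enorm_ne_top]
    simpa using this
  · intro f g _ hf hg hPf hPg
    refine tendsto_of_tendsto_of_tendsto_of_le_of_le tendsto_const_nhds
      (by simpa using hPf.add hPg) (fun _ => zero_le) fun T => ?_
    have hm := (h.aestronglyMeasurable_meanDev hf.1 T).enorm
    dsimp only
    rw [← lintegral_add_left' hm]
    refine lintegral_mono fun ω => ?_
    have : meanDev Y P (f + g) T ω = meanDev Y P f T ω + meanDev Y P g T ω := by
      simp only [meanDev, Pi.add_apply, integral_add hf hg, Finset.sum_add_distrib, smul_add]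
      abel
    rw [this]
    exact enorm_add_le _ _
  · rw [← isSeqClosed_iff_isClosed]
    intro u f hu hlim
    refine happrox f (L1.integrable_coeFn f) fun ε hε => ?_
    have := (EMetric.tendsto_atTop.1 hlim) ε hε
    obtain ⟨n, hn⟩ := this
    refine ⟨u n, L1.integrable_coeFn _, ?_, hu n⟩
    have := (hn n le_rfl).le
    rwa [edist_comm, Lp.edist_def, eLpNorm_one_eq_lintegral_enorm] at this
  · intro f g hfg hf hPf
    have hae : ∀ t, ∀ᵐ ω ∂μ, f (Y t ω) = g (Y t ω) := fun t => by
      rw [← h.map_eq t] at hfg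
      exact ae_of_ae_map (h.measurable t).aemeasurable hfg
    refine hPf.congr fun T => lintegral_congr_ae ?_
    filter_upwards [ae_all_iff.2 hae] with ω hω
    simp only [meanDev, hω, integral_congr_ae hfg]

end PairwiseMixing

end MixingLLN

/-! ### Windows of stationary, absolutely regular series -/

section Stationarity

variable {Ω : Type*} [MeasurableSpace Ω] {d : ℕ} {X : ℤ → Ω → Fin d → ℝ} {μ : Measure Ω}

lemma measurable_path (hX : ∀ t, Measurable (X t)) (s : ℤ) :
    Measurable fun ω (t : ℤ) => X (t + s) ω :=
  measurable_pi_lambda _ fun t => hX (t + s)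

lemma measurable_timeShift (s : ℤ) : Measurable fun (x : ℤ → Fin d → ℝ) (t : ℤ) => x (t + s) :=
  measurable_pi_lambda _ fun t => measurable_pi_apply (t + s)

lemma measurable_past (hX : ∀ t, Measurable (X t)) : Measurable (past X) :=
  measurable_pi_lambda _ fun s => hX s

lemma measurable_future (hX : ∀ t, Measurable (X t)) (n : ℕ) : Measurable (future X n) :=
  measurable_pi_lambda _ fun s => hX s

lemma measurable_dataWindow (hX : ∀ t, Measurable (X t)) (p : ℕ) (t : ℤ) :
    Measurable (dataWindow p X t) :=
  measurable_pi_lambda _ fun k => hX (t + k)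

lemma StrictlyStationary.map_shift (h : StrictlyStationary X μ) (hX : ∀ t, Measurable (X t))
    (s : ℤ) : μ.map (fun ω (t : ℤ) => X (t + s) ω) = μ.map (fun ω (t : ℤ) => X t ω) := by
  have hcomp : ∀ r s : ℤ, μ.map (fun ω (t : ℤ) => X (t + (r + s)) ω)
      = (μ.map (fun ω (t : ℤ) => X (t + s) ω)).map (fun x (t : ℤ) => x (t + r)) := by
    intro r s
    rw [Measure.map_map (measurable_timeShift r) (measurable_path hX s)]
    simp only [Function.comp_def, add_assoc]
  have hnat : ∀ n : ℕ, μ.map (fun ω (t : ℤ) => X (t + n) ω) = μ.map (fun ω (t : ℤ) => X t ω) := by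
    intro n
    induction n with
    | zero => simp
    | succ n ih =>
      rw [Nat.cast_succ, hcomp n 1, show μ.map (fun ω (t : ℤ) => X (t + 1) ω) = _ from h,
        Measure.map_map (measurable_timeShift _) (by simpa using measurable_path hX 0)]
      exact ih
  obtain ⟨n, rfl | rfl⟩ := s.eq_nat_or_neg
  · exact hnat n
  · have := hcomp (-n) n
    rw [hnat n, Measure.map_map (measurable_timeShift _) (by simpa using measurable_path hX 0)]
      at this
    simp only [neg_add_cancel, add_zero] at this
    exact this.symm

/-- Probabilities of events about the whole series do not change when time is shifted. -/
lemma StrictlyStationary.measureReal_shift (h : StrictlyStationary X μ)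
    (hX : ∀ t, Measurable (X t)) (s : ℤ) {S : Set (ℤ → Fin d → ℝ)} (hS : MeasurableSet S) :
    μ.real {ω | (fun t => X (t + s) ω) ∈ S} = μ.real {ω | (fun t => X t ω) ∈ S} := by
  have := congrArg (fun ν : Measure _ => ν.real S) (h.map_shift hX s)
  rwa [map_measureReal_apply (measurable_path hX s) hS,
    map_measureReal_apply (by simpa using measurable_path hX 0) hS] at this

lemma StrictlyStationary.map_dataWindow (h : StrictlyStationary X μ)
    (hX : ∀ t, Measurable (X t)) (p : ℕ) (s t : ℤ) :
    μ.map (dataWindow p X s) = μ.map (dataWindow p X t) := by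
  have key : ∀ s, μ.map (dataWindow p X s)
      = (μ.map (fun ω (t : ℤ) => X t ω)).map fun x (k : Fin (p + 1)) => x k := by
    intro s
    rw [← h.map_shift hX s, Measure.map_map
      (measurable_pi_lambda _ fun k => measurable_pi_apply _) (measurable_path hX s)]
    congr 1
    funext ω k
    simp [dataWindow, add_comm]
  rw [key, key]

lemma abs_measureReal_sub_le_betaMixing [IsProbabilityMeasure μ] (hX : ∀ t, Measurable (X t))
    (n : ℕ) {A : Set (Set.Iic (0 : ℤ) → Fin d → ℝ)} {B : Set (Set.Ici (n : ℤ) → Fin d → ℝ)}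
    (hA : MeasurableSet A) (hB : MeasurableSet B) :
    |μ.real (past X ⁻¹' A ∩ future X n ⁻¹' B) - μ.real (past X ⁻¹' A) * μ.real (future X n ⁻¹' B)|
      ≤ betaMixing X μ n := by
  have hp := measurable_past hX
  have hf := measurable_future hX n
  have := Measure.isProbabilityMeasure_map (μ := μ) hp.aemeasurable
  have := Measure.isProbabilityMeasure_map (μ := μ) hf.aemeasurable
  have := Measure.isProbabilityMeasure_map (μ := μ) (hp.prodMk hf).aemeasurable
  have hbdd : BddAbove (Set.range fun A : {A : Set ((Set.Iic (0 : ℤ) → Fin d → ℝ) ×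
      (Set.Ici (n : ℤ) → Fin d → ℝ)) // MeasurableSet A} =>
      |(μ.map fun ω => (past X ω, future X n ω)).real A.1
        - ((μ.map (past X)).prod (μ.map (future X n))).real A.1|) := by
    refine ⟨1, ?_⟩
    rintro _ ⟨S, rfl⟩
    refine abs_sub_le_iff.2 ⟨?_, ?_⟩
    · exact (sub_le_self _ measureReal_nonneg).trans measureReal_le_one
    · exact (sub_le_self _ measureReal_nonneg).trans measureReal_le_one
  have hle := le_ciSup hbdd ⟨A ×ˢ B, hA.prod hB⟩
  simp only [measureReal_prod_prod, map_measureReal_apply hp hA, map_measureReal_apply hf hB,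
    map_measureReal_apply (hp.prodMk hf) (hA.prod hB)] at hle
  exact hle

/-- The windows of an absolutely regular stationary series are pairwise mixing: a window at lag
`n ≥ p` is a function of the future from time `n - p` on, seen from the end of the first window. -/
lemma pairwiseMixing_dataWindow [IsProbabilityMeasure μ] (hX : ∀ t, Measurable (X t))
    (hstat : StrictlyStationary X μ) (hreg : AbsolutelyRegular X μ) (p : ℕ) :
    PairwiseMixing (fun t : ℕ => dataWindow p X (t + 1)) μ (μ.map (dataWindow p X 1))
      (fun n => if n < p then 1 else betaMixing X μ (n - p)) where
  measurable t := measurable_dataWindow hX p _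
  map_eq t := hstat.map_dataWindow hX p _ _
  tendsto := by
    refine Tendsto.congr' ?_ (hreg.comp (tendsto_sub_atTop_nat p))
    filter_upwards [eventually_ge_atTop p] with n hn
    simp [hn.not_gt]
  cov_le := by
    intro s t hst A hA
    have hlaw : ∀ r : ℤ, (μ.map (dataWindow p X 1)).real A = μ.real (dataWindow p X r ⁻¹' A) := by
      intro r
      rw [hstat.map_dataWindow hX p 1 r, map_measureReal_apply (measurable_dataWindow hX p r) hA]
    split_ifs with hp
    · have := Measure.isProbabilityMeasure_map (μ := μ) (measurable_dataWindow hX p 1).aemeasurable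
      refine abs_sub_le_iff.2 ⟨?_, ?_⟩
      · exact (sub_le_self _ (sq_nonneg _)).trans measureReal_le_one
      · exact (sub_le_self _ measureReal_nonneg).trans
          (pow_le_one₀ measureReal_nonneg measureReal_le_one)
    · push Not at hp
      -- shift time such that the first window ends at time `0`; the second one then begins at time `n`
      obtain ⟨n, hn⟩ : ∃ n, n = t - s - p := ⟨_, rfl⟩
      have hnt : (t : ℤ) = s + p + n := by omega
      rw [← hn]
      set f : (Set.Iic (0 : ℤ) → Fin d → ℝ) → Fin (p + 1) → Fin d → ℝ :=
        fun x k => x ⟨k - p, by simp only [Set.mem_Iic]; omega⟩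
      set g : (Set.Ici (n : ℤ) → Fin d → ℝ) → Fin (p + 1) → Fin d → ℝ :=
        fun x k => x ⟨n + k, by simp only [Set.mem_Ici]; omega⟩
      have hf : Measurable f := measurable_pi_lambda _ fun k => measurable_pi_apply _
      have hg : Measurable g := measurable_pi_lambda _ fun k => measurable_pi_apply _
      have hpast : past X ⁻¹' (f ⁻¹' A) = dataWindow p X (-p) ⁻¹' A := by
        ext ω
        have : f (past X ω) = dataWindow p X (-p) ω := by
          funext k; simp only [f, past, dataWindow]; congr 2; ring
        simp only [Set.mem_preimage, this]
      have hfut : future X n ⁻¹' (g ⁻¹' A) = dataWindow p X n ⁻¹' A := rfl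
      have hmain := abs_measureReal_sub_le_betaMixing (μ := μ) hX n (hf hA) (hg hA)
      rw [hpast, hfut, ← hlaw, ← hlaw, ← sq] at hmain
      have hS : MeasurableSet {x : ℤ → Fin d → ℝ | (fun k : Fin (p + 1) => x (-p + k)) ∈ A ∧
          (fun k : Fin (p + 1) => x (n + k)) ∈ A} :=
        MeasurableSet.inter
          ((measurable_pi_lambda _ fun k => measurable_pi_apply _ :
            Measurable fun (x : ℤ → Fin d → ℝ) (k : Fin (p + 1)) => x (-p + k)) hA)
          ((measurable_pi_lambda _ fun k => measurable_pi_apply _ :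
            Measurable fun (x : ℤ → Fin d → ℝ) (k : Fin (p + 1)) => x (n + k)) hA)
      have hsh := hstat.measureReal_shift hX (s + 1 + p) hS
      convert hmain using 3
      refine Eq.trans ?_ hsh
      congr 1
      ext ω
      have e1 : ∀ k : Fin (p + 1), (-p + k + (s + 1 + p) : ℤ) = s + 1 + k := fun k => by ring
      have e2 : ∀ k : Fin (p + 1), (n + k + (s + 1 + p) : ℤ) = t + 1 + k := fun k => by
        rw [hnt]; ring
      simp only [Set.mem_inter_iff, Set.mem_preimage, Set.mem_ofPred_eq, e1, e2]
      rfl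

end Stationarity

/-! ### Transformations and sample means of mixing sequences -/

section MixingTools

variable {Ω 𝒴 𝒵 : Type*} [MeasurableSpace Ω] [MeasurableSpace 𝒴] [MeasurableSpace 𝒵]
  {Y : ℕ → Ω → 𝒴} {μ : Measure Ω} {P : Measure 𝒴} {b : ℕ → ℝ}

namespace PairwiseMixing

lemma comp (h : PairwiseMixing Y μ P b) {f : 𝒴 → 𝒵} (hf : Measurable f) :
    PairwiseMixing (fun t ω => f (Y t ω)) μ (P.map f) b where
  measurable t := hf.comp (h.measurable t)
  map_eq t := by rw [← h.map_eq t, Measure.map_map hf (h.measurable t)]; rfl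
  tendsto := h.tendsto
  cov_le s t hst A hA := by
    rw [map_measureReal_apply hf hA]
    exact h.cov_le s t hst _ (hf hA)

lemma tendsto_measureReal_le_norm_meanDev {B : Type*} [NormedAddCommGroup B] [NormedSpace ℝ B]
    [CompleteSpace B] [IsProbabilityMeasure μ] (h : PairwiseMixing Y μ P b) {g : 𝒴 → B}
    (hg : Integrable g P) {ε : ℝ} (hε : 0 < ε) :
    Tendsto (fun T => μ.real {ω | ε ≤ ‖meanDev Y P g T ω‖}) atTop (𝓝 0) := by
  have h0 : ENNReal.ofReal ε ≠ 0 := by simpa using hε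
  have hlim : Tendsto (fun T => (∫⁻ ω, ‖meanDev Y P g T ω‖ₑ ∂μ) / ENNReal.ofReal ε) atTop (𝓝 0) := by
    simpa using ENNReal.Tendsto.div_const (h.tendsto_lintegral_meanDev hg) (Or.inr h0)
  have hμ : Tendsto (fun T => μ {ω | ε ≤ ‖meanDev Y P g T ω‖}) atTop (𝓝 0) := by
    refine tendsto_of_tendsto_of_tendsto_of_le_of_le tendsto_const_nhds hlim
      (fun _ => zero_le) fun T => ?_
    have := meas_ge_le_lintegral_div (h.aestronglyMeasurable_meanDev hg.1 T).enorm h0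
      ENNReal.ofReal_ne_top
    refine le_trans (measure_mono fun ω hω => ?_) this
    simp only [Set.mem_ofPred_eq] at hω ⊢
    rw [← ofReal_norm]
    exact ENNReal.ofReal_le_ofReal hω
  exact (ENNReal.tendsto_toReal ENNReal.zero_ne_top).comp hμ

/-- Markov's inequality for sample means of a nonnegative function. -/
lemma measureReal_le_sampleMean_le [IsProbabilityMeasure μ] (h : PairwiseMixing Y μ P b)
    {φ : 𝒴 → ℝ} (hφ : ∀ y, 0 ≤ φ y) (hi : Integrable φ P) {ε : ℝ} (hε : 0 < ε) (T : ℕ) :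
    μ.real {ω | ε ≤ (T : ℝ)⁻¹ * ∑ t ∈ Finset.range T, φ (Y t ω)} ≤ (∫ y, φ y ∂P) / ε := by
  have hi' : ∀ t, Integrable (fun ω => φ (Y t ω)) μ := fun t => by
    rw [← h.map_eq t] at hi
    exact hi.comp_measurable (h.measurable t)
  have he : ∀ t, ∫ ω, φ (Y t ω) ∂μ = ∫ y, φ y ∂P := fun t => by
    rw [← h.map_eq t] at hi ⊢
    exact (integral_map (h.measurable t).aemeasurable hi.1).symm
  have hm := mul_meas_ge_le_integral_of_nonneg (μ := μ)
    (f := fun ω => (T : ℝ)⁻¹ * ∑ t ∈ Finset.range T, φ (Y t ω))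
    (ae_of_all _ fun ω => mul_nonneg (by positivity) (Finset.sum_nonneg fun t _ => hφ _))
    ((integrable_finsetSum _ fun t _ => hi' t).const_mul _) ε
  rw [le_div_iff₀ hε, mul_comm]
  refine hm.trans ?_
  rw [integral_const_mul, integral_finsetSum _ fun t _ => hi' t]
  simp only [he, Finset.sum_const, Finset.card_range, nsmul_eq_mul]
  rcases T.eq_zero_or_pos with rfl | hT
  · simpa using integral_nonneg hφ
  · rw [inv_mul_cancel_left₀ (by positivity)]

end PairwiseMixing

end MixingTools

/-! ### The uniform distribution -/

section Uniform

/-- The uniform distribution on the unit interval. -/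
noncomputable abbrev unif : Measure ℝ := volume.restrict (Set.Ioo 0 1)

instance : IsProbabilityMeasure unif := ⟨by simp⟩

lemma unif_real_Iic {v : ℝ} (hv : v ∈ Set.Icc (0 : ℝ) 1) : unif.real (Set.Iic v) = v := by
  rw [← measureReal_congr (Iio_ae_eq_Iic (a := v)), measureReal_restrict_apply measurableSet_Iio,
    Set.inter_comm, Set.Ioo_inter_Iio, min_eq_right hv.2, Real.volume_real_Ioo_of_le hv.1, sub_zero]

lemma map_one_sub_unif : unif.map (fun x => 1 - x) = unif := by
  have h := (Measure.measurePreserving_sub_left (volume : Measure ℝ) 1).restrict_preimage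
    (measurableSet_Ioo (a := (0 : ℝ)) (b := 1))
  have e : (fun x : ℝ => 1 - x) ⁻¹' Set.Ioo 0 1 = Set.Ioo 0 1 := by
    ext x; simp
  rw [e] at h
  exact h.map_eq

/-- Probability integral transform. -/
lemma map_cdf_eq_unif (ν : Measure ℝ) [IsProbabilityMeasure ν]
    (hc : Continuous fun z => ν.real (Set.Iic z)) :
    ν.map (fun z => ν.real (Set.Iic z)) = unif := by
  set F : ℝ → ℝ := fun z => ν.real (Set.Iic z)
  have hmono : Monotone F := fun x y hxy => measureReal_mono (Set.Iic_subset_Iic.2 hxy)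
  have hcdf : F = ProbabilityTheory.cdf ν := by
    funext z; rw [ProbabilityTheory.cdf_eq_real]
  have hbot : Tendsto F atBot (𝓝 0) := hcdf ▸ ProbabilityTheory.tendsto_cdf_atBot ν
  have htop : Tendsto F atTop (𝓝 1) := hcdf ▸ ProbabilityTheory.tendsto_cdf_atTop ν
  have := Measure.isProbabilityMeasure_map (μ := ν) hc.measurable.aemeasurable
  have hsol : ∀ v ∈ Set.Ioo (0 : ℝ) 1, ∃ z, F z = v := by
    intro v hv
    obtain ⟨z₀, h₀⟩ := (hbot.eventually (gt_mem_nhds hv.1)).exists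
    obtain ⟨z₁, h₁⟩ := (htop.eventually (lt_mem_nhds hv.2)).exists
    obtain ⟨z, -, hz⟩ := mem_range_of_exists_le_of_exists_ge hc ⟨z₀, h₀.le⟩ ⟨z₁, h₁.le⟩
    exact ⟨z, rfl⟩
  -- up to a null set, `{F ≤ v}` is `Iic z` for any solution `z` of `F z = v`
  have hlow : ∀ v ∈ Set.Ioo (0 : ℝ) 1, v ≤ ν.real (F ⁻¹' Set.Iic v) := by
    intro v hv
    obtain ⟨z, rfl⟩ := hsol v hv
    exact measureReal_mono fun y hy => hmono hy
  have hup : ∀ v ∈ Set.Ioo (0 : ℝ) 1, ν.real (F ⁻¹' Set.Iio v) ≤ v := by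
    intro v hv
    obtain ⟨z, rfl⟩ := hsol v hv
    exact measureReal_mono fun y hy => not_lt.1 fun h => (hmono h.le).not_gt hy
  refine Measure.ext_of_Iic _ _ fun v => ?_
  rw [← measureReal_eq_measureReal_iff, map_measureReal_apply hc.measurable measurableSet_Iic]
  rcases lt_or_ge v 0 with h0 | h0
  · have e1 : F ⁻¹' Set.Iic v = ∅ := by
      ext z
      simp only [Set.mem_preimage, Set.mem_Iic, Set.mem_empty_iff_false, iff_false, not_le]
      exact h0.trans_le measureReal_nonneg
    have e2 : Set.Iic v ∩ Set.Ioo 0 1 = ∅ := by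
      ext z
      simp only [Set.mem_inter_iff, Set.mem_Iic, Set.mem_Ioo, Set.mem_empty_iff_false, iff_false]
      rintro ⟨a, b, -⟩
      linarith
    rw [e1, measureReal_restrict_apply measurableSet_Iic, e2]
    simp
  rcases le_or_gt 1 v with h1 | h1
  · have e1 : F ⁻¹' Set.Iic v = Set.univ := by
      ext z
      simp only [Set.mem_preimage, Set.mem_Iic, Set.mem_univ, iff_true]
      exact measureReal_le_one.trans h1
    have e2 : Set.Iic v ∩ Set.Ioo 0 1 = Set.Ioo 0 1 := by
      ext z
      simp only [Set.mem_inter_iff, Set.mem_Iic, Set.mem_Ioo, and_iff_right_iff_imp]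
      rintro ⟨-, b⟩
      linarith
    rw [e1, measureReal_restrict_apply measurableSet_Iic, e2]
    simp
  rw [unif_real_Iic ⟨h0, h1.le⟩]
  refine le_antisymm (le_of_forall_gt_imp_ge_of_dense fun w hw => ?_) ?_
  · rcases lt_or_ge w 1 with hw1 | hw1
    · refine le_trans (measureReal_mono ?_) (hup w ⟨h0.trans_lt hw, hw1⟩)
      exact fun z hz => lt_of_le_of_lt hz hw
    · exact measureReal_le_one.trans hw1
  · rcases h0.eq_or_lt with rfl | h0
    · exact measureReal_nonneg
    · exact hlow v ⟨h0, h1⟩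

/-- The truncated inverse power `u^{-γ} 1(u ≤ a)`, which dominates the weighted tail
`v^{-γ} 1(u ≤ v)` for every `v ≤ a`. -/
noncomputable def invPow (γ a : ℝ) : ℝ → ℝ := (Set.Ioc 0 a).indicator fun u => u ^ (-γ)

lemma invPow_nonneg (γ a u : ℝ) : 0 ≤ invPow γ a u :=
  Set.indicator_nonneg (fun _ hx => Real.rpow_nonneg hx.1.le _) u

lemma integrable_invPow {γ a : ℝ} (hγ : γ < 1) : Integrable (invPow γ a) unif := by
  refine Integrable.indicator ?_ measurableSet_Ioc
  exact (intervalIntegral.integrableOn_Ioo_rpow_iff zero_lt_one).2 (by linarith)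

lemma tendsto_integral_invPow {γ : ℝ} (hγ : γ < 1) :
    Tendsto (fun a => ∫ u, invPow γ a u ∂unif) (𝓝[>] 0) (𝓝 0) := by
  have hb : Integrable (fun u : ℝ => u ^ (-γ)) unif :=
    (intervalIntegral.integrableOn_Ioo_rpow_iff zero_lt_one).2 (by linarith)
  have := tendsto_integral_filter_of_dominated_convergence (μ := unif) (l := 𝓝[>] (0 : ℝ))
    (F := fun a => invPow γ a) (f := fun _ => 0) (fun u => ‖u ^ (-γ)‖)
    (.of_forall fun a => (integrable_invPow hγ).1)
    (.of_forall fun a => ae_of_all _ fun u => norm_indicator_le_norm_self _ _) hb.norm ?_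
  · simpa using this
  refine (ae_restrict_mem measurableSet_Ioo).mono fun u hu => ?_
  refine tendsto_const_nhds.congr' ?_
  filter_upwards [nhdsWithin_le_nhds (gt_mem_nhds hu.1)] with a ha
  simp [invPow, ha.not_ge]

end Uniform

/-! ### Glivenko–Cantelli theorems -/

section GlivenkoCantelli

variable {Ω : Type*} [MeasurableSpace Ω] {U : ℕ → Ω → ℝ} {μ : Measure Ω} {b : ℕ → ℝ}

open Classical in
/-- Glivenko–Cantelli theorem (in probability) for a mixing sequence of uniform variables, with the
upper bound for the empirical distribution function and the lower bound for its left limits. -/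
lemma PairwiseMixing.tendsto_measureReal_glivenkoCantelli [IsProbabilityMeasure μ]
    (h : PairwiseMixing U μ unif b) {ε : ℝ} (hε : 0 < ε) :
    Tendsto (fun T : ℕ => μ.real {ω | ¬ ∀ v ∈ Set.Icc (0 : ℝ) 1,
      (((Finset.range T).filter fun t => U t ω ≤ v).card : ℝ) ≤ T * (v + ε) ∧
      T * (v - ε) ≤ ((Finset.range T).filter fun t => U t ω < v).card}) atTop (𝓝 0) := by
  obtain ⟨m, hm⟩ := exists_nat_gt (2 / ε)
  have hm0 : (0 : ℝ) < m := lt_trans (by positivity) hm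
  have hmε : 1 / (m : ℝ) < ε / 2 := by
    rw [div_lt_div_iff₀ hm0 two_pos]; rw [div_lt_iff₀ hε] at hm; linarith
  have hgrid : Tendsto (fun T => ∑ k ∈ Finset.range (m + 1), μ.real {ω | ε / 2 ≤
      ‖meanDev U unif ((Set.Iic ((k : ℝ) / m)).indicator (1 : ℝ → ℝ)) T ω‖}) atTop (𝓝 0) := by
    have := tendsto_finsetSum (Finset.range (m + 1)) fun k _ =>
      h.tendsto_measureReal_le_norm_meanDev
        (g := (Set.Iic ((k : ℝ) / m)).indicator (1 : ℝ → ℝ))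
        ((integrable_const (1 : ℝ)).indicator measurableSet_Iic) (half_pos hε)
    simpa using this
  refine squeeze_zero' (.of_forall fun _ => measureReal_nonneg) ?_ hgrid
  filter_upwards [eventually_gt_atTop 0] with T hT
  have hT' : (0 : ℝ) < T := by exact_mod_cast hT
  refine le_trans (measureReal_mono ?_ (measure_ne_top _ _)) (measureReal_biUnion_finset_le _ _)
  intro ω hbad
  by_contra hω
  refine hbad ?_
  simp only [Set.mem_iUnion, Set.mem_ofPred_eq, not_exists, not_le, Finset.mem_range] at hω
  -- the bounds at the grid points
  have hcnt : ∀ k ≤ m, |(((Finset.range T).filter fun t => U t ω ≤ (k : ℝ) / m).card : ℝ)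
      - T * ((k : ℝ) / m)| < T * (ε / 2) := by
    intro k hk
    have h1 := hω k (by omega)
    have hk' : (k : ℝ) / m ∈ Set.Icc (0 : ℝ) 1 :=
      ⟨by positivity, (div_le_one hm0).2 (by exact_mod_cast hk)⟩
    rw [meanDev, integral_indicator_one measurableSet_Iic, unif_real_Iic hk', Real.norm_eq_abs] at h1
    have h2 : ∑ t ∈ Finset.range T, (Set.Iic ((k : ℝ) / m)).indicator (1 : ℝ → ℝ) (U t ω)
        = (((Finset.range T).filter fun t => U t ω ≤ (k : ℝ) / m).card : ℝ) := by
      simp [Set.indicator_apply, Finset.sum_boole]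
    rw [h2, smul_eq_mul] at h1
    have h3 := mul_lt_mul_of_pos_left h1 hT'
    rwa [← abs_of_pos hT', ← abs_mul, mul_sub, abs_of_pos hT', mul_inv_cancel_left₀ hT'.ne'] at h3
  intro v hv
  -- `K / m` is the grid point next to the right of `v`
  set K := ⌈v * m⌉₊ with hK
  have hKm : K ≤ m := by
    rw [hK, Nat.ceil_le]
    exact mul_le_of_le_one_left hm0.le hv.2
  have hvK : v ≤ (K : ℝ) / m := (le_div_iff₀ hm0).2 (Nat.le_ceil _)
  have hKv : (K : ℝ) / m < v + 1 / m := by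
    rw [div_lt_iff₀ hm0, add_mul, one_div_mul_cancel hm0.ne']
    exact Nat.ceil_lt_add_one (mul_nonneg hv.1 hm0.le)
  constructor
  · have h1 := (abs_lt.1 (hcnt K hKm)).2
    have h2 : (((Finset.range T).filter fun t => U t ω ≤ v).card : ℝ)
        ≤ ((Finset.range T).filter fun t => U t ω ≤ (K : ℝ) / m).card := by
      exact_mod_cast Finset.card_le_card
        (Finset.monotone_filter_right _ fun t _ ht => le_trans ht hvK)
    have h3 : T * ((K : ℝ) / m) ≤ T * (v + ε / 2) := by gcongr; linarith
    nlinarith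
  · rcases hv.1.eq_or_lt with rfl | hv0
    · have : (0 : ℝ) ≤ ((Finset.range T).filter fun t => U t ω < 0).card := Nat.cast_nonneg _
      nlinarith
    · obtain ⟨k, hk⟩ : ∃ k, K = k + 1 :=
        Nat.exists_eq_succ_of_ne_zero (Nat.ceil_pos.2 (by positivity)).ne'
      have h1 := (abs_lt.1 (hcnt k (by omega))).1
      have hkv : (k : ℝ) / m < v := by
        rw [div_lt_iff₀ hm0]
        exact Nat.lt_ceil.1 (by omega)
      have h2 : (((Finset.range T).filter fun t => U t ω ≤ (k : ℝ) / m).card : ℝ)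
          ≤ ((Finset.range T).filter fun t => U t ω < v).card := by
        exact_mod_cast Finset.card_le_card
          (Finset.monotone_filter_right _ fun t _ ht => lt_of_le_of_lt ht hkv)
      have h4 : v ≤ (k : ℝ) / m + 1 / m := by
        rw [hk] at hvK; push_cast at hvK; rw [← add_div]; exact hvK
      have h3 : T * (v - ε / 2) ≤ T * ((k : ℝ) / m) := by gcongr; linarith
      nlinarith

end GlivenkoCantelli

section WeightedGlivenkoCantelli

/-- In the tail `v ≤ a`, the identity is a small multiple of the weight `v ^ γ`, as `γ < 1`. -/
lemma le_rpow_mul {γ a v : ℝ} (hγ : γ < 1) (hv : 0 < v) (hva : v ≤ a) :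
    v ≤ a ^ (1 - γ) * v ^ γ := by
  calc v = v ^ (1 - γ) * v ^ γ := by rw [← Real.rpow_add hv, sub_add_cancel, Real.rpow_one]
    _ ≤ a ^ (1 - γ) * v ^ γ := by
      gcongr

lemma self_le_rpow {γ v : ℝ} (hγ : γ ≤ 1) (hv : v ∈ Set.Ioo (0 : ℝ) 1) : v ≤ v ^ γ := by
  simpa using Real.rpow_le_rpow_of_exponent_ge hv.1 hv.2.le hγ

lemma rpow_le_two_mul_weight {γ v : ℝ} (hγ : γ ≤ 1) (hv : v ∈ Set.Ioo (0 : ℝ) 1)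
    (h : v ≤ 1 / 2) : v ^ γ ≤ 2 * weight γ v := by
  have h1 := self_le_rpow hγ (v := 1 - v) ⟨by linarith [hv.2], by linarith [hv.1]⟩
  have h2 := Real.rpow_nonneg hv.1.le γ
  unfold weight
  nlinarith

lemma weight_one_sub (γ v : ℝ) : weight γ (1 - v) = weight γ v := by
  simp [weight, mul_comm]

/-- Comparison of an empirical and a uniform distribution function at `v`, relative to the weight:
in the tails both are small relative to the weight, in the middle the weight is bounded below. The
hypothesis `hC` keeps `v` away from `1`, where the empirical distribution function with the
denominator `T + 1` has the error `1 / (T + 1)`. -/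
lemma abs_sub_le_weight {γ a v ε n T : ℝ} (hγ : γ < 1) (hv : v ∈ Set.Ioo (0 : ℝ) 1)
    (ha : 0 < a) (ha2 : a ≤ 1 / 2) (haε : a ^ (1 - γ) ≤ ε) (hT : 0 < T) (hn : 0 ≤ n)
    (hnT : n ≤ T) (hL : v ≤ a → n ≤ ε * T * v ^ γ)
    (hR : 1 - v ≤ a → T - n ≤ ε * T * (1 - v) ^ γ) (hC : 1 / (T + 1) ≤ ε * (1 - v) ^ γ)
    (hM : |n / (T + 1) - v| ≤ ε * (a * a)) :
    |n / (T + 1) - v| ≤ 4 * ε * weight γ v := by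
  have hε : 0 ≤ ε := (Real.rpow_nonneg ha.le _).trans haε
  have hv' : 1 - v ∈ Set.Ioo (0 : ℝ) 1 := ⟨by linarith [hv.2], by linarith [hv.1]⟩
  have hq : n / (T + 1) ≤ n / T := by gcongr; linarith
  have hw0 : 0 ≤ weight γ v :=
    mul_nonneg (Real.rpow_nonneg hv.1.le _) (Real.rpow_nonneg hv'.1.le _)
  by_cases h1 : v ≤ a
  · have hw := mul_le_mul_of_nonneg_left (rpow_le_two_mul_weight hγ.le hv (h1.trans ha2)) hε
    have e1 : n / T ≤ ε * v ^ γ := by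
      rw [div_le_iff₀ hT]; linarith [hL h1]
    have e2 : v ≤ ε * v ^ γ := (le_rpow_mul hγ hv.1 h1).trans
      (mul_le_mul_of_nonneg_right haε (Real.rpow_nonneg hv.1.le _))
    have e3 : 0 ≤ n / (T + 1) := by positivity
    have e4 := mul_nonneg hε hw0
    rw [abs_le]
    constructor <;> linarith [hv.1]
  by_cases h2 : 1 - v ≤ a
  · have hw := mul_le_mul_of_nonneg_left (rpow_le_two_mul_weight hγ.le hv' (h2.trans ha2)) hε
    rw [weight_one_sub] at hw
    have e1 : (T - n) / (T + 1) ≤ ε * (1 - v) ^ γ := by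
      refine le_trans (div_le_div_of_nonneg_left (by linarith) hT (by linarith)) ?_
      rw [div_le_iff₀ hT]; linarith [hR h2]
    have e2 : 1 - v ≤ ε * (1 - v) ^ γ := (le_rpow_mul hγ hv'.1 h2).trans
      (mul_le_mul_of_nonneg_right haε (Real.rpow_nonneg hv'.1.le _))
    have e3 : n / (T + 1) = 1 - (T - n) / (T + 1) - 1 / (T + 1) := by
      field_simp; ring
    have e4 : 0 ≤ (T - n) / (T + 1) := div_nonneg (by linarith) (by linarith)
    have e5 : 0 ≤ 1 / (T + 1) := by positivity
    have e6 := mul_nonneg hε hw0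
    rw [abs_le]
    constructor <;> linarith [hv'.1]
  · push Not at h1 h2
    have hw : a * a ≤ weight γ v :=
      mul_le_mul (h1.le.trans (self_le_rpow hγ.le hv)) (h2.le.trans (self_le_rpow hγ.le hv'))
        ha.le (Real.rpow_nonneg hv.1.le _)
    have := mul_le_mul_of_nonneg_left hw hε
    have e4 := mul_nonneg hε hw0
    linarith

open Classical in
/-- The left tail of the empirical distribution, relative to `v ^ γ`, is controlled by a single sample
mean for all `v ≤ a`. -/
lemma card_le_of_sampleMean_invPow_lt {γ a v ε : ℝ} (hγ : 0 ≤ γ) {T : ℕ} {U : ℕ → ℝ}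
    (hU : ∀ t < T, 0 < U t) (h : (T : ℝ)⁻¹ * ∑ t ∈ Finset.range T, invPow γ a (U t) < ε)
    (hv : 0 < v) (hva : v ≤ a) :
    (((Finset.range T).filter fun t => U t ≤ v).card : ℝ) ≤ ε * T * v ^ γ := by
  rcases T.eq_zero_or_pos with rfl | hT
  · simp
  have hT' : (0 : ℝ) < T := by exact_mod_cast hT
  have h1 : (((Finset.range T).filter fun t => U t ≤ v).card : ℝ) * v ^ (-γ)
      ≤ ∑ t ∈ Finset.range T, invPow γ a (U t) := by
    rw [← nsmul_eq_mul, ← Finset.sum_const]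
    refine le_trans (Finset.sum_le_sum fun t ht => ?_)
      (Finset.sum_le_sum_of_subset_of_nonneg (Finset.filter_subset (fun t => U t ≤ v) _)
        fun t _ _ => invPow_nonneg γ a _)
    obtain ⟨ht, htv⟩ := Finset.mem_filter.1 ht
    have h0 := hU t (Finset.mem_range.1 ht)
    rw [invPow, Set.indicator_of_mem (Set.mem_Ioc.2 ⟨h0, htv.trans hva⟩)]
    exact Real.rpow_le_rpow_of_nonpos h0 htv (by linarith)
  rw [inv_mul_lt_iff₀ hT'] at h
  rw [Real.rpow_neg hv.le, ← div_eq_mul_inv, div_le_iff₀ (Real.rpow_pos_of_pos hv γ)] at h1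
  have := Real.rpow_nonneg hv.le γ
  nlinarith

variable {Ω : Type*} [MeasurableSpace Ω] {U : ℕ → Ω → ℝ} {μ : Measure Ω} {b : ℕ → ℝ}

lemma PairwiseMixing.measureReal_preimage_Iic [IsProbabilityMeasure μ]
    (h : PairwiseMixing U μ unif b) (t : ℕ) {a : ℝ} (ha : 0 ≤ a) :
    μ.real {ω | U t ω ≤ a} ≤ a := by
  rcases le_or_gt a 1 with h1 | h1
  · rw [show {ω | U t ω ≤ a} = U t ⁻¹' Set.Iic a from rfl,
      ← map_measureReal_apply (h.measurable t) measurableSet_Iic, h.map_eq, unif_real_Iic ⟨ha, h1⟩]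
  · exact measureReal_le_one.trans h1.le

lemma PairwiseMixing.one_sub (h : PairwiseMixing U μ unif b) :
    PairwiseMixing (fun t ω => 1 - U t ω) μ unif b := by
  have := h.comp (f := fun x => 1 - x) (by fun_prop)
  rwa [map_one_sub_unif] at this

lemma PairwiseMixing.ae_mem_Ioo (h : PairwiseMixing U μ unif b) :
    ∀ᵐ ω ∂μ, ∀ t, U t ω ∈ Set.Ioo (0 : ℝ) 1 := by
  refine ae_all_iff.2 fun t => ?_
  have : ∀ᵐ u ∂(μ.map (U t)), u ∈ Set.Ioo (0 : ℝ) 1 := by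
    rw [h.map_eq]; exact ae_restrict_mem measurableSet_Ioo
  exact ae_of_ae_map (h.measurable t).aemeasurable this

/-- No variable among the first `T + p` is closer to `0` than `c / T`, with high probability. -/
lemma PairwiseMixing.measureReal_exists_le_div [IsProbabilityMeasure μ]
    (h : PairwiseMixing U μ unif b) {c : ℝ} (hc : 0 ≤ c) {p T : ℕ} (hT : 0 < T) (hp : p ≤ T) :
    μ.real {ω | ∃ t < T + p, U t ω ≤ c / T} ≤ 2 * c := by
  have hT' : (0 : ℝ) < T := by exact_mod_cast hT
  have hp' : (p : ℝ) ≤ T := by exact_mod_cast hp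
  have e : {ω | ∃ t < T + p, U t ω ≤ c / T}
      = ⋃ t ∈ Finset.range (T + p), {ω | U t ω ≤ c / T} := by
    ext ω; simp
  rw [e]
  refine (measureReal_biUnion_finset_le _ _).trans ((Finset.sum_le_card_nsmul _ _ (c / T)
    fun t _ => h.measureReal_preimage_Iic t (by positivity)).trans ?_)
  rw [Finset.card_range, nsmul_eq_mul, mul_div_assoc', div_le_iff₀ hT']
  push_cast
  nlinarith

/-- The rescaling error `1 / (T + 1)` is negligible relative to the weight at distance `c / T` from the
end of the unit interval. -/
lemma eventually_inv_le_rpow {γ c ε : ℝ} (hγ : γ < 1) (hc : 0 < c) (hε : 0 < ε) :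
    ∀ᶠ T : ℕ in atTop, 1 / ((T : ℝ) + 1) ≤ ε * (c / T) ^ γ := by
  have h1 : Tendsto (fun T : ℕ => (T : ℝ) ^ (-(1 - γ))) atTop (𝓝 0) :=
    (tendsto_rpow_neg_atTop (by linarith)).comp tendsto_natCast_atTop_atTop
  have h2 : 0 < ε * c ^ γ := by positivity
  filter_upwards [h1.eventually (gt_mem_nhds h2), eventually_gt_atTop 0] with T hT hT0
  have hT' : (0 : ℝ) < T := by exact_mod_cast hT0
  calc 1 / ((T : ℝ) + 1) ≤ 1 / T := by gcongr; linarith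
    _ = (T : ℝ) ^ (-(1 - γ)) / T ^ γ := by
      rw [← Real.rpow_sub hT', neg_sub, show γ - 1 - γ = -1 by ring, Real.rpow_neg_one, one_div]
    _ ≤ ε * c ^ γ / T ^ γ := by gcongr
    _ = ε * (c / T) ^ γ := by rw [Real.div_rpow hc.le hT'.le, mul_div_assoc]

open Classical in
/-- Weighted Glivenko–Cantelli theorem at the sample points: with probability tending to one, the
rescaled empirical distribution function of `Z 0, …, Z (T - 1)` is inside `(0, 1)`, and within `δ`
times the weight of the distribution function, at all of the points `Z 0, …, Z (T + p - 1)`. -/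
theorem PairwiseMixing.tendsto_measureReal_weighted [IsProbabilityMeasure μ] {Z : ℕ → Ω → ℝ}
    {ν : Measure ℝ} (h : PairwiseMixing Z μ ν b) (hc : Continuous fun z => ν.real (Set.Iic z))
    {γ δ : ℝ} (hγ₀ : 0 ≤ γ) (hγ₁ : γ < 1) (hδ : 0 < δ) (p : ℕ) :
    Tendsto (fun T : ℕ => μ.real {ω | ¬ ∀ t < T + p,
      ν.real (Set.Iic (Z t ω)) ∈ Set.Ioo (0 : ℝ) 1 ∧
      (((Finset.range T).filter fun s => Z s ω ≤ Z t ω).card : ℝ) / (T + 1) ∈ Set.Ioo (0 : ℝ) 1 ∧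
      |(((Finset.range T).filter fun s => Z s ω ≤ Z t ω).card : ℝ) / (T + 1)
        - ν.real (Set.Iic (Z t ω))| ≤ δ * weight γ (ν.real (Set.Iic (Z t ω)))}) atTop (𝓝 0) := by
  have := h.isProbabilityMeasure
  set F : ℝ → ℝ := fun z => ν.real (Set.Iic z)
  have hmono : Monotone F := fun x y hxy => measureReal_mono (Set.Iic_subset_Iic.2 hxy)
  set U : ℕ → Ω → ℝ := fun t ω => F (Z t ω)
  have hU : PairwiseMixing U μ unif b := by
    have := h.comp hc.measurable
    rwa [map_cdf_eq_unif ν hc] at this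
  have hU' := hU.one_sub
  rw [Metric.tendsto_nhds]
  intro η' hη'
  obtain ⟨η, hη, rfl⟩ : ∃ η, 0 < η ∧ η' = 8 * η := ⟨η' / 8, by positivity, by ring⟩
  obtain ⟨ε, hε, hεδ⟩ : ∃ ε, 0 < ε ∧ δ = 4 * ε := ⟨δ / 4, by positivity, by ring⟩
  -- `a` is the length of the tails; `invPow` is small in mean, and so is the probability that one of
  -- the `p` later points is below `ε * (a * a)`
  obtain ⟨a, ha, ha2, haε, hai, hap⟩ : ∃ a : ℝ, 0 < a ∧ a ≤ 1 / 2 ∧ a ^ (1 - γ) ≤ ε ∧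
      ∫ u, invPow γ a u ∂unif ≤ η * ε ∧ p * (ε * (a * a)) ≤ η := by
    have h1 : Tendsto (fun a : ℝ => a ^ (1 - γ)) (𝓝[>] 0) (𝓝 0) := by
      have := (Real.continuousAt_rpow_const 0 (1 - γ) (Or.inr (by linarith))).tendsto
      rw [Real.zero_rpow (by linarith)] at this
      exact this.mono_left nhdsWithin_le_nhds
    have h2 : Tendsto (fun a : ℝ => p * (ε * (a * a))) (𝓝[>] 0) (𝓝 0) := by
      have : Continuous fun a : ℝ => p * (ε * (a * a)) := by fun_prop
      have := this.tendsto 0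
      simp only [mul_zero] at this
      exact this.mono_left nhdsWithin_le_nhds
    have h3 : ∀ᶠ a : ℝ in 𝓝[>] 0, a ≤ 1 / 2 :=
      nhdsWithin_le_nhds (Iic_mem_nhds (by norm_num))
    have h4 : ∀ᶠ a : ℝ in 𝓝[>] 0, 0 < a := self_mem_nhdsWithin
    obtain ⟨a, h⟩ := (h4.and (h3.and
      ((h1.eventually (gt_mem_nhds hε)).and (((tendsto_integral_invPow hγ₁).eventually
      (gt_mem_nhds (mul_pos hη hε))).and (h2.eventually (gt_mem_nhds hη)))))).exists
    exact ⟨a, h.1, h.2.1, h.2.2.1.le, h.2.2.2.1.le, h.2.2.2.2.le⟩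
  have hr : 0 < ε * (a * a) / 2 := by positivity
  have hinv : ∀ᶠ T : ℕ in atTop, 1 / ((T : ℝ) + 1) ≤ ε * (a * a) / 2 :=
    (tendsto_one_div_add_atTop_nhds_zero_nat.eventually (gt_mem_nhds hr)).mono fun _ h => h.le
  filter_upwards [eventually_gt_atTop 0, eventually_ge_atTop p, hinv,
    (hU.tendsto_measureReal_glivenkoCantelli hr).eventually (gt_mem_nhds hη),
    eventually_inv_le_rpow hγ₁ hη hε] with T hT hpT hinvT hgc hCT
  have hT' : (0 : ℝ) < T := by exact_mod_cast hT
  rw [Real.dist_eq, sub_zero, abs_of_nonneg measureReal_nonneg]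
  -- exceptional events: a point too close to `1`, a large sample mean for the left or the right tail,
  -- failure of the Glivenko–Cantelli bound, and a later point where the empirical distribution function
  -- might vanish
  set E₁ : Set Ω := {ω | ∃ t < T + p, 1 - U t ω ≤ η / T}
  set E₂ : Set Ω := {ω | ε ≤ (T : ℝ)⁻¹ * ∑ t ∈ Finset.range T, invPow γ a (U t ω)}
  set E₃ : Set Ω := {ω | ε ≤ (T : ℝ)⁻¹ * ∑ t ∈ Finset.range T, invPow γ a (1 - U t ω)}
  set E₄ : Set Ω := {ω | ¬ ∀ v ∈ Set.Icc (0 : ℝ) 1,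
    (((Finset.range T).filter fun t => U t ω ≤ v).card : ℝ) ≤ T * (v + ε * (a * a) / 2) ∧
    T * (v - ε * (a * a) / 2) ≤ ((Finset.range T).filter fun t => U t ω < v).card}
  set E₅ : Set Ω := ⋃ k ∈ Finset.range p, {ω | U (T + k) ω ≤ ε * (a * a)}
  have m₀ : μ.real {ω | ¬ ∀ t, U t ω ∈ Set.Ioo (0 : ℝ) 1} = 0 := by
    rw [Measure.real, ae_iff.1 hU.ae_mem_Ioo, ENNReal.toReal_zero]
  have m₁ : μ.real E₁ ≤ 2 * η := hU'.measureReal_exists_le_div hη.le hT hpT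
  have m₂ : μ.real E₂ ≤ η := (hU.measureReal_le_sampleMean_le (invPow_nonneg γ a)
    (integrable_invPow hγ₁) hε T).trans ((div_le_iff₀ hε).2 hai)
  have m₃ : μ.real E₃ ≤ η := (hU'.measureReal_le_sampleMean_le (invPow_nonneg γ a)
    (integrable_invPow hγ₁) hε T).trans ((div_le_iff₀ hε).2 hai)
  have m₅ : μ.real E₅ ≤ η := by
    refine (measureReal_biUnion_finset_le _ _).trans ((Finset.sum_le_card_nsmul _ _ (ε * (a * a))
      fun k _ => hU.measureReal_preimage_Iic _ (by positivity)).trans ?_)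
    rwa [Finset.card_range, nsmul_eq_mul]
  refine lt_of_le_of_lt (b := μ.real ({ω | ¬ ∀ t, U t ω ∈ Set.Ioo (0 : ℝ) 1} ∪
    (E₁ ∪ (E₂ ∪ (E₃ ∪ (E₄ ∪ E₅)))))) (measureReal_mono ?_) ?_
  swap
  · have u1 := measureReal_union_le (μ := μ) {ω | ¬ ∀ t, U t ω ∈ Set.Ioo (0 : ℝ) 1}
      (E₁ ∪ (E₂ ∪ (E₃ ∪ (E₄ ∪ E₅))))
    have u2 := measureReal_union_le (μ := μ) E₁ (E₂ ∪ (E₃ ∪ (E₄ ∪ E₅)))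
    have u3 := measureReal_union_le (μ := μ) E₂ (E₃ ∪ (E₄ ∪ E₅))
    have u4 := measureReal_union_le (μ := μ) E₃ (E₄ ∪ E₅)
    have u5 := measureReal_union_le (μ := μ) E₄ E₅
    linarith
  intro ω hbad
  by_contra hω
  refine hbad fun t ht => ?_
  simp only [Set.mem_union, not_or] at hω
  obtain ⟨h0, h1, h2, h3, h4, h5⟩ := hω
  have g0 : ∀ t, U t ω ∈ Set.Ioo (0 : ℝ) 1 := not_not.1 h0
  have g1 : η / T < 1 - U t ω := not_le.1 fun hle => h1 ⟨t, ht, hle⟩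
  have g2 : (T : ℝ)⁻¹ * ∑ t ∈ Finset.range T, invPow γ a (U t ω) < ε := not_le.1 h2
  have g3 : (T : ℝ)⁻¹ * ∑ t ∈ Finset.range T, invPow γ a (1 - U t ω) < ε := not_le.1 h3
  have g4 := not_not.1 h4 (U t ω) ⟨(g0 t).1.le, (g0 t).2.le⟩
  have hv := g0 t
  obtain ⟨N, hN⟩ : ∃ N, N = ((Finset.range T).filter fun s => Z s ω ≤ Z t ω).card := ⟨_, rfl⟩
  change U t ω ∈ _ ∧ _ ∧ _
  change U t ω ∈ _ ∧ _ ∧ |_ - U t ω| ≤ δ * weight γ (U t ω)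
  rw [← hN]
  -- `U s < U t` implies `Z s ≤ Z t`, which implies `U s ≤ U t`
  have hNle : N ≤ ((Finset.range T).filter fun s => U s ω ≤ U t ω).card := by
    rw [hN]
    exact Finset.card_le_card (Finset.monotone_filter_right _ fun s _ hs => hmono hs)
  have hNge : ((Finset.range T).filter fun s => U s ω < U t ω).card ≤ N := by
    rw [hN]
    refine Finset.card_le_card (Finset.monotone_filter_right _ fun s _ hs => ?_)
    exact (not_lt.1 fun hlt => (hmono hlt.le).not_gt hs)
  have hNT : N ≤ T := by
    rw [hN]; exact (Finset.card_filter_le _ _).trans (by simp)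
  have hNle' : (N : ℝ) ≤ ((Finset.range T).filter fun s => U s ω ≤ U t ω).card := by
    exact_mod_cast hNle
  have hNge' : (((Finset.range T).filter fun s => U s ω < U t ω).card : ℝ) ≤ N := by
    exact_mod_cast hNge
  have hNT' : (N : ℝ) ≤ T := by exact_mod_cast hNT
  have hM : |(N : ℝ) / (T + 1) - U t ω| ≤ ε * (a * a) := by
    have e1 : (N : ℝ) / (T + 1) ≤ N / T := by gcongr; linarith
    have e2 : (N : ℝ) / T ≤ U t ω + ε * (a * a) / 2 := by
      rw [div_le_iff₀ hT']; linarith [g4.1]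
    have e3 : (U t ω - ε * (a * a) / 2) ≤ N / T := by
      rw [le_div_iff₀ hT']; linarith [g4.2]
    have e4 : (N : ℝ) / T ≤ N / (T + 1) + 1 / (T + 1) := by
      rw [← add_div, div_le_div_iff₀ hT' (by linarith)]
      nlinarith
    rw [abs_le]
    constructor <;> linarith
  refine ⟨hv, ⟨?_, ?_⟩, ?_⟩
  · -- positivity: a sample point counts itself, a later point is not in the lower tail
    have hT1 : (0 : ℝ) < T + 1 := by linarith
    rcases lt_or_ge t T with htT | htT
    · refine div_pos ?_ hT1
      have : 0 < N := by
        rw [hN, Finset.card_pos]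
        exact ⟨t, by simp [htT]⟩
      exact_mod_cast this
    · obtain ⟨k, rfl⟩ := Nat.exists_eq_add_of_le htT
      have : ε * (a * a) < U (T + k) ω := by
        refine not_le.1 fun hle => h5 ?_
        simp only [E₅, Set.mem_iUnion]
        exact ⟨k, by simpa using ht, hle⟩
      linarith [(abs_le.1 hM).1]
  · rw [div_lt_one (by linarith)]
    linarith
  · rw [hεδ]
    refine abs_sub_le_weight hγ₁ hv ha ha2 haε hT' (Nat.cast_nonneg _) hNT' (fun hva => ?_)
      (fun hva => ?_) ?_ hM
    · exact hNle'.trans (card_le_of_sampleMean_invPow_lt hγ₀ (fun s _ => (g0 s).1) g2 hv.1 hva)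
    · have := card_le_of_sampleMean_invPow_lt hγ₀ (fun s _ => by linarith [(g0 s).2]) g3
        (by linarith [hv.2] : 0 < 1 - U t ω) hva
      refine le_trans ?_ this
      have hsplit := Finset.card_filter_add_card_filter_not (s := Finset.range T)
        (fun s => U s ω < U t ω)
      have e : ((Finset.range T).filter fun s => ¬ U s ω < U t ω)
          = (Finset.range T).filter fun s => 1 - U s ω ≤ 1 - U t ω := by
        refine Finset.filter_congr fun s _ => ?_
        rw [not_lt, sub_le_sub_iff_left]
      rw [e, Finset.card_range] at hsplit
      have : (T : ℝ) = (((Finset.range T).filter fun s => U s ω < U t ω).card : ℝ)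
          + ((Finset.range T).filter fun s => 1 - U s ω ≤ 1 - U t ω).card := by
        exact_mod_cast hsplit.symm
      linarith
    · refine hCT.trans ?_
      gcongr

end WeightedGlivenkoCantelli

/-! ### Perturbation of the margins -/

section Perturbation

variable {d p : ℕ}

lemma isOpen_openCube : IsOpen (openCube d p) := by
  have : openCube d p = ⋂ t, ⋂ j, (fun u : Fin (p + 1) → Fin d → ℝ => u t j) ⁻¹' Set.Ioo 0 1 := by
    ext u; simp [openCube]
  rw [this]
  exact isOpen_iInter_of_finite fun t => isOpen_iInter_of_finite fun j =>
    isOpen_Ioo.preimage ((continuous_apply j).comp (continuous_apply t))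

lemma weight_nonneg {γ v : ℝ} (hv : v ∈ Set.Icc (0 : ℝ) 1) : 0 ≤ weight γ v :=
  mul_nonneg (Real.rpow_nonneg hv.1 _) (Real.rpow_nonneg (by linarith [hv.2]) _)

open Classical in
/-- The margins `F + s (G - F)` at the coordinates of the window `x`, and `F` elsewhere. Only the
values at the coordinates of `x` matter for `applyMargins _ x`, and no bound on `G - F` is required
at other points. -/
noncomputable def interpMargins (F G : Fin d → ℝ → ℝ) (x : Fin (p + 1) → Fin d → ℝ) (s : ℝ) :
    Fin d → ℝ → ℝ :=
  fun j z => if ∃ k, z = x k j then F j z + s * (G j z - F j z) else F j z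

lemma applyMargins_interpMargins (F G : Fin d → ℝ → ℝ) (x : Fin (p + 1) → Fin d → ℝ) (s : ℝ) :
    applyMargins (interpMargins F G x s) x
      = applyMargins F x + s • (applyMargins G x - applyMargins F x) := by
  funext k j
  have h : ∃ k', x k j = x k' j := ⟨k, rfl⟩
  simp [applyMargins, interpMargins, h]

lemma interpMargins_mem_openCube {F G : Fin d → ℝ → ℝ} {x : Fin (p + 1) → Fin d → ℝ} {s : ℝ}
    (hF : applyMargins F x ∈ openCube d p) (hG : applyMargins G x ∈ openCube d p)
    (hs : s ∈ Set.Icc (0 : ℝ) 1) : applyMargins (interpMargins F G x s) x ∈ openCube d p := by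
  intro k j
  rw [applyMargins_interpMargins]
  exact (convex_Ioo (0 : ℝ) 1).add_smul_sub_mem (hF k j) (hG k j) hs

lemma interpMargins_mem_marginNhd {F G : Fin d → ℝ → ℝ} {x : Fin (p + 1) → Fin d → ℝ} {s γ δ : ℝ}
    (hF : ∀ j z, F j z ∈ Set.Icc (0 : ℝ) 1) (hδ : 0 ≤ δ) (hs : s ∈ Set.Icc (0 : ℝ) 1)
    (hG : ∀ k j, G j (x k j) ∈ Set.Icc (0 : ℝ) 1)
    (hFG : ∀ k j, |G j (x k j) - F j (x k j)| ≤ δ * weight γ (F j (x k j))) :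
    interpMargins F G x s ∈ marginNhd γ δ F := by
  intro j z
  unfold interpMargins
  split_ifs with h
  · obtain ⟨k, rfl⟩ := h
    refine ⟨(convex_Icc (0 : ℝ) 1).add_smul_sub_mem (hF _ _) (hG k j) hs, ?_⟩
    rw [sub_add_cancel_left, abs_neg, abs_mul, abs_of_nonneg hs.1]
    exact (mul_le_of_le_one_left (abs_nonneg _) hs.2).trans (hFG k j)
  · refine ⟨hF _ _, ?_⟩
    rw [sub_self, abs_zero]
    exact mul_nonneg hδ (weight_nonneg (hF j z))

lemma apply_eq_sum_single {E : Type*} [NormedAddCommGroup E] [NormedSpace ℝ E]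
    (L : (Fin (p + 1) → Fin d → ℝ) →L[ℝ] E) (v : Fin (p + 1) → Fin d → ℝ) :
    L v = ∑ k, ∑ j, v k j • L (Pi.single k (Pi.single j 1)) := by
  have : v = ∑ k, ∑ j, v k j • (Pi.single k (Pi.single j 1) : Fin (p + 1) → Fin d → ℝ) := by
    funext k j
    simp [Finset.sum_apply, Pi.single_apply, ite_apply]
  conv_lhs => rw [this]
  simp

/-- Mean value inequality for a change of margins, which is small relative to the weight: the partial
derivatives along the segment are bounded after multiplication with the weight. -/
lemma norm_sub_le_of_margins {E : Type*} [NormedAddCommGroup E] [NormedSpace ℝ E]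
    {φ : (Fin (p + 1) → Fin d → ℝ) → E} (hφ : DifferentiableOn ℝ φ (openCube d p))
    {F G : Fin d → ℝ → ℝ} (hF : ∀ j z, F j z ∈ Set.Icc (0 : ℝ) 1) {x : Fin (p + 1) → Fin d → ℝ}
    (hFx : applyMargins F x ∈ openCube d p) (hGx : applyMargins G x ∈ openCube d p)
    {γ δ δ' : ℝ} (hδ' : 0 ≤ δ') (hδ : δ' ≤ δ)
    (hFG : ∀ k j, |G j (x k j) - F j (x k j)| ≤ δ' * weight γ (F j (x k j)))
    {H : Fin (p + 1) → Fin d → ℝ}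
    (hH : ∀ G' ∈ marginNhd γ δ F, applyMargins G' x ∈ openCube d p → ∀ k j,
      ‖weight γ (F j (x k j)) •
        fderiv ℝ φ (applyMargins G' x) (Pi.single k (Pi.single j 1))‖ ≤ H k j) :
    ‖φ (applyMargins G x) - φ (applyMargins F x)‖ ≤ δ' * ∑ k, ∑ j, H k j := by
  set u := applyMargins F x with hu
  set v := applyMargins G x - u with hv
  have hcube : ∀ s ∈ Set.Icc (0 : ℝ) 1, u + s • v ∈ openCube d p := fun s hs => by
    rw [hv, hu, ← applyMargins_interpMargins]
    exact interpMargins_mem_openCube hFx hGx hs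
  have hderiv : ∀ s ∈ Set.Icc (0 : ℝ) 1,
      HasDerivWithinAt (fun s : ℝ => φ (u + s • v)) (fderiv ℝ φ (u + s • v) v) (Set.Icc 0 1) s := by
    intro s hs
    have h1 : HasFDerivAt φ (fderiv ℝ φ (u + s • v)) (u + s • v) :=
      ((hφ _ (hcube s hs)).differentiableAt (isOpen_openCube.mem_nhds (hcube s hs))).hasFDerivAt
    have h2 : HasDerivAt (fun s : ℝ => u + s • v) v s := by
      simpa using ((hasDerivAt_id s).smul_const v).const_add u
    exact (h1.comp_hasDerivAt s h2).hasDerivWithinAt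
  have hbound : ∀ s ∈ Set.Ico (0 : ℝ) 1,
      ‖fderiv ℝ φ (u + s • v) v‖ ≤ δ' * ∑ k, ∑ j, H k j := by
    intro s hs
    have hs' : s ∈ Set.Icc (0 : ℝ) 1 := ⟨hs.1, hs.2.le⟩
    have hmem := interpMargins_mem_marginNhd (G := G) (x := x) (γ := γ) (δ := δ) hF (hδ'.trans hδ)
      hs' (fun k j => Set.Ioo_subset_Icc_self (hGx k j)) fun k j => (hFG k j).trans
        (mul_le_mul_of_nonneg_right hδ (weight_nonneg (hF _ _)))
    have hb := hH _ hmem (interpMargins_mem_openCube hFx hGx hs')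
    rw [applyMargins_interpMargins] at hb
    rw [apply_eq_sum_single, Finset.mul_sum]
    refine (norm_sum_le _ _).trans (Finset.sum_le_sum fun k _ => ?_)
    rw [Finset.mul_sum]
    refine (norm_sum_le _ _).trans (Finset.sum_le_sum fun j _ => ?_)
    calc ‖v k j • fderiv ℝ φ (u + s • v) (Pi.single k (Pi.single j 1))‖
        ≤ δ' * weight γ (F j (x k j)) * ‖fderiv ℝ φ (u + s • v) (Pi.single k (Pi.single j 1))‖ := by
          rw [norm_smul]
          gcongr
          exact hFG k j
      _ = δ' * ‖weight γ (F j (x k j)) •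
            fderiv ℝ φ (u + s • v) (Pi.single k (Pi.single j 1))‖ := by
          rw [norm_smul, Real.norm_of_nonneg (weight_nonneg (hF _ _)), mul_assoc]
      _ ≤ δ' * H k j := by
          gcongr
          exact hb k j
  have := norm_image_sub_le_of_norm_deriv_le_segment_01' hderiv hbound
  simpa [hv] using this

end Perturbation

/-! ### Consistency -/

section Consistency

lemma FiniteMean.exists_integrable {E : Type*} [MeasurableSpace E] {P : Measure E} {f : E → ℝ≥0∞}
    (h : FiniteMean P f) : ∃ g : E → ℝ, (∀ x, 0 ≤ g x) ∧ Integrable g P ∧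
      ∀ᵐ x ∂P, f x ≤ ENNReal.ofReal (g x) := by
  obtain ⟨g, hg, hfg, hi⟩ := h
  refine ⟨fun x => (g x).toReal, fun x => ENNReal.toReal_nonneg,
    integrable_toReal_of_lintegral_ne_top hg.aemeasurable hi.ne, ?_⟩
  filter_upwards [hfg, ae_lt_top hg hi.ne] with x hx hx'
  rwa [ENNReal.ofReal_toReal hx'.ne]

lemma sum_Icc_one_eq_sum_range {E : Type*} [AddCommMonoid E] (f : ℤ → E) (T : ℕ) :
    ∑ t ∈ Finset.Icc (1 : ℤ) T, f t = ∑ t ∈ Finset.range T, f (t + 1) := by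
  refine (Finset.sum_nbij' (fun t : ℕ => (t : ℤ) + 1) (fun t => (t - 1).toNat) ?_ ?_ ?_ ?_ ?_).symm
  · intro t ht; simp only [Finset.mem_range, Finset.mem_Icc] at ht ⊢; omega
  · intro t ht; simp only [Finset.mem_range, Finset.mem_Icc] at ht ⊢; omega
  · intro t _; simp
  · intro t ht; simp only [Finset.mem_Icc] at ht; omega
  · intro t _; rfl

open Classical in
lemma empMargin_eq {Ω : Type*} {d : ℕ} {X : ℤ → Ω → Fin d → ℝ} (T : ℕ) (ω : Ω) (j : Fin d)
    (z : ℝ) : empMargin X T ω j z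
      = (((Finset.range T).filter fun s : ℕ => X (s + 1) ω j ≤ z).card : ℝ) / (T + 1) := by
  rw [empMargin, sum_Icc_one_eq_sum_range, Finset.sum_boole]

variable {Ω : Type*} [MeasurableSpace Ω] {μ : Measure Ω} {d p : ℕ} {X : ℤ → Ω → Fin d → ℝ}

lemma pairwiseMixing_coord {b : ℕ → ℝ} {P : Measure (Fin (p + 1) → Fin d → ℝ)}
    (hW : PairwiseMixing (fun t : ℕ => dataWindow p X (t + 1)) μ P b) (j : Fin d) :
    PairwiseMixing (fun (t : ℕ) ω => X (t + 1) ω j) μ (P.map fun x => x 0 j) b := by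
  have := hW.comp (f := fun x : Fin (p + 1) → Fin d → ℝ => x 0 j) (by fun_prop)
  simpa [dataWindow] using this

lemma margin_eq (hX : ∀ t, Measurable (X t)) (j : Fin d) (z : ℝ) :
    margin X μ j z = ((μ.map (dataWindow p X 1)).map fun x => x 0 j).real (Set.Iic z) := by
  rw [Measure.map_map (by fun_prop) (measurable_dataWindow hX p 1),
    map_measureReal_apply ((by fun_prop : Measurable fun x : Fin (p + 1) → Fin d → ℝ => x 0 j).comp
      (measurable_dataWindow hX p 1)) measurableSet_Iic]
  simp [margin, dataWindow, Set.preimage]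

variable [IsProbabilityMeasure μ]

lemma margin_mem_Icc (j : Fin d) (z : ℝ) : margin X μ j z ∈ Set.Icc (0 : ℝ) 1 :=
  ⟨measureReal_nonneg, measureReal_le_one⟩

variable (hX : ∀ t, Measurable (X t)) (hstat : StrictlyStationary X μ)
  (hreg : AbsolutelyRegular X μ) (hcont : ∀ j, Continuous (margin X μ j))

include hX hstat hreg hcont

lemma ae_margin_mem_openCube (p : ℕ) :
    ∀ᵐ x ∂(μ.map (dataWindow p X 1)), applyMargins (margin X μ) x ∈ openCube d p := by
  have hW := pairwiseMixing_dataWindow hX hstat hreg p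
  have hmeas : MeasurableSet {x : Fin (p + 1) → Fin d → ℝ |
      applyMargins (margin X μ) x ∈ openCube d p} := by
    refine isOpen_openCube.measurableSet.preimage (measurable_pi_lambda _ fun k =>
      measurable_pi_lambda _ fun j => (hcont j).measurable.comp (by fun_prop))
  rw [ae_map_iff (measurable_dataWindow hX p 1).aemeasurable hmeas]
  have hall : ∀ j, ∀ᵐ ω ∂μ, ∀ t : ℕ, margin X μ j (X (t + 1) ω j) ∈ Set.Ioo (0 : ℝ) 1 := by
    intro j
    have hZ := pairwiseMixing_coord hW j
    have := hZ.isProbabilityMeasure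
    have hc : Continuous fun z =>
        ((μ.map (dataWindow p X 1)).map fun x => x 0 j).real (Set.Iic z) := by
      simpa only [← margin_eq hX] using hcont j
    have hU := hZ.comp hc.measurable
    rw [map_cdf_eq_unif _ hc] at hU
    simpa only [← margin_eq hX] using hU.ae_mem_Ioo
  filter_upwards [ae_all_iff.2 hall] with ω hω
  intro k j
  have := hω j k
  rwa [add_comm] at this

/-- With probability tending to one, the empirical margins at all of the windows are in the open
cube and close to the true margins relative to the weight. -/
lemma tendsto_measureReal_empMargin (p : ℕ) {γ δ : ℝ} (hγ₀ : 0 ≤ γ) (hγ₁ : γ < 1) (hδ : 0 < δ) :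
    Tendsto (fun T : ℕ => μ.real {ω | ¬ ∀ t < T,
      applyMargins (empMargin X T ω) (dataWindow p X (t + 1) ω) ∈ openCube d p ∧
      ∀ k j, |empMargin X T ω j (dataWindow p X (t + 1) ω k j)
        - margin X μ j (dataWindow p X (t + 1) ω k j)|
          ≤ δ * weight γ (margin X μ j (dataWindow p X (t + 1) ω k j))}) atTop (𝓝 0) := by
  classical
  have hW := pairwiseMixing_dataWindow hX hstat hreg p
  have hlim := tendsto_finsetSum (Finset.univ : Finset (Fin d)) fun j _ =>
    (pairwiseMixing_coord hW j).tendsto_measureReal_weighted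
      (by simpa only [← margin_eq hX] using hcont j) hγ₀ hγ₁ hδ p
  simp only [Finset.sum_const_zero, ← margin_eq hX, ← empMargin_eq] at hlim
  refine squeeze_zero (fun _ => measureReal_nonneg) (fun T => ?_) hlim
  refine le_trans (measureReal_mono ?_ (measure_ne_top _ _)) (measureReal_biUnion_finset_le _ _)
  intro ω hbad
  by_contra hω
  refine hbad fun t ht => ?_
  simp only [Set.mem_iUnion, Set.mem_ofPred_eq, Finset.mem_univ, exists_prop, true_and, not_exists,
    not_not] at hω
  have key : ∀ (k : Fin (p + 1)) (j : Fin d),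
      dataWindow p X (t + 1) ω k j = X ((t + k : ℕ) + 1) ω j := by
    intro k j
    rw [dataWindow, Nat.cast_add, add_right_comm]
  refine ⟨fun k j => ?_, fun k j => ?_⟩
  · rw [applyMargins, key]
    exact (hω j (t + k) (by omega)).2.1
  · rw [key]
    exact (hω j (t + k) (by omega)).2.2

end Consistency

section UniformLaw

/-- A random function which is dominated on a compact set of parameters is an integrable random
element of the space of continuous functions. -/
lemma exists_integrable_continuousMap {α 𝒰 𝒴 E : Type*} [MetricSpace α] [TopologicalSpace 𝒰]
    [MeasurableSpace 𝒰] [BorelSpace 𝒰] [MeasurableSpace 𝒴]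
    [NormedAddCommGroup E] [SecondCountableTopology E] {P : Measure 𝒴} {K : Set α} [CompactSpace K]
    {S : Set 𝒰} (hS : MeasurableSet S) {f : α → 𝒰 → E}
    (hf : ContinuousOn (Function.uncurry f) (K ×ˢ S)) {v : 𝒴 → 𝒰} (hv : Measurable v)
    (hvS : ∀ᵐ y ∂P, v y ∈ S) {g : 𝒴 → ℝ} (hg : Integrable g P) (hg0 : ∀ y, 0 ≤ g y)
    (hfg : ∀ᵐ y ∂P, ∀ θ ∈ K, ‖f θ (v y)‖ ≤ g y) :
    ∃ G : 𝒴 → C(K, E), Integrable G P ∧ ∀ y, v y ∈ S → ∀ θ : K, G y θ = f θ (v y) := by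
  classical
  borelize C(K, E)
  let F : C(S × K, E) := ⟨fun z => f z.2 z.1,
    hf.comp_continuous (f := fun z : S × K => ((z.2 : α), (z.1 : 𝒰))) (by fun_prop)
      fun z => ⟨z.2.2, z.1.2⟩⟩
  let G : 𝒴 → C(K, E) := fun y => if h : v y ∈ S then F.curry ⟨v y, h⟩ else 0
  have hGm : Measurable G := by
    refine Measurable.dite (s := v ⁻¹' S) (f := fun y => F.curry ⟨v y.1, y.2⟩)
      (g := fun _ => 0) ?_ measurable_const (hv hS)
    exact F.curry.continuous.measurable.comp
      ((hv.comp measurable_subtype_coe).subtype_mk)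
  have hG : ∀ y, v y ∈ S → ∀ θ : K, G y θ = f θ (v y) := by
    intro y hy θ
    simp only [G, dif_pos hy]
    rfl
  refine ⟨G, hg.mono' hGm.aestronglyMeasurable ?_, hG⟩
  filter_upwards [hvS, hfg] with y hy hy'
  rw [ContinuousMap.norm_le _ (hg0 y)]
  intro θ
  rw [hG y hy]
  exact hy' θ θ.2

end UniformLaw

end SVine

theorem mainTheorem10 {Ω : Type*} [MeasurableSpace Ω] (μ : Measure Ω) [IsProbabilityMeasure μ]
    (d p : ℕ) (X : ℤ → Ω → Fin d → ℝ) (hX : ∀ t, Measurable (X t))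
    (hstat : SVine.StrictlyStationary X μ) (hreg : SVine.AbsolutelyRegular X μ)
    (hcont : ∀ j, Continuous (SVine.margin X μ j))
    (V : SVine.GraphSeq (SVine.Vtx d)) (hV : SVine.IsStationaryVine V (p + 1))
    (M : SVine.PairCopulaModel V) (Θ : Set M.Param) (hΘ : UniqueDiffOn ℝ Θ)
    (hM : ∀ θ ∈ Θ, ∀ c, SVine.IsCopulaDensity (M.density c (M.block θ c)))
    (γ : ℝ) (hγ₀ : 0 ≤ γ) (hγ₁ : γ < 1) (θs : M.Param)
    (hθs : SVine.meanScore M Θ (μ.map (SVine.dataWindow p X 1)) (SVine.margin X μ) θs = 0)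
    (hSP1 : SVine.Identifiable M Θ (μ.map (SVine.dataWindow p X 1)) (SVine.margin X μ) θs)
    (hSP2 : SVine.RegularScore M Θ (μ.map (SVine.dataWindow p X 1)) (SVine.margin X μ) γ)
    (θhat : ℕ → Ω → M.Param)
    (hsolve : Tendsto (fun T => μ {ω | ¬ SVine.SolvesEstimatingEq p M Θ X T ω (θhat T ω)})
      atTop (𝓝 0))
    (htight : ∀ η : ℝ≥0∞, 0 < η → ∃ K : Set M.Param, IsCompact K ∧ K ⊆ Θ ∧
      ∀ᶠ T in atTop, μ {ω | θhat T ω ∉ K} ≤ η) :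
    TendstoInMeasure μ θhat atTop (fun _ => θs) := by
  open SVine in
  set P := μ.map (dataWindow p X 1) with hP
  set F := margin X μ
  have hW := pairwiseMixing_dataWindow hX hstat hreg p
  have hcube := ae_margin_mem_openCube hX hstat hreg hcont p
  have hFmem : ∀ j z, F j z ∈ Set.Icc (0 : ℝ) 1 := margin_mem_Icc
  obtain ⟨δ, hδ, hmom⟩ := hSP2.moments
  have hFnhd : F ∈ marginNhd γ δ F := fun j z => ⟨hFmem j z, by
    rw [sub_self, abs_zero]; exact mul_nonneg hδ.le (weight_nonneg (hFmem j z))⟩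
  rw [tendstoInMeasure_iff_norm]
  intro ε hε
  obtain ⟨c, hc, hsep⟩ := hSP1.separated (ε / 2) (half_pos hε)
  suffices h : Tendsto (fun T => μ.real {ω | ε ≤ ‖θhat T ω - θs‖}) atTop (𝓝 0) by
    simpa [Measure.real] using ENNReal.tendsto_ofReal h
  have hsolve' : Tendsto (fun T => μ.real {ω | ¬ SolvesEstimatingEq p M Θ X T ω (θhat T ω)})
      atTop (𝓝 0) := (ENNReal.tendsto_toReal ENNReal.zero_ne_top).comp hsolve
  rw [Metric.tendsto_nhds]
  intro η' hη'
  obtain ⟨η, hη, rfl⟩ : ∃ η, 0 < η ∧ η' = 6 * η := ⟨η' / 6, by positivity, by ring⟩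
  obtain ⟨K, hK, hKΘ, hKη⟩ := htight (ENNReal.ofReal η) (by simpa using hη)
  have : CompactSpace K := isCompact_iff_compactSpace.1 hK
  obtain ⟨hmom₁, hmom₂⟩ := hmom K hK hKΘ
  -- integrable majorants of the score and of its weighted partial derivatives
  obtain ⟨g, hg0, hgi, hg⟩ := hmom₁.exists_integrable
  choose h hh0 hhi hh using fun k j => (hmom₂ k j).exists_integrable
  have hg' : ∀ᵐ x ∂P, ∀ θ ∈ K, ‖M.score Θ θ (applyMargins F x)‖ ≤ g x := by
    filter_upwards [hg, hcube] with x hx hxc θ hθ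
    have h1 : ‖M.score Θ θ (applyMargins F x)‖ₑ ≤ ENNReal.ofReal (g x) := by
      refine le_trans ?_ hx
      refine le_trans ?_ (le_iSup₂_of_le θ hθ (le_iSup₂_of_le F hFnhd (le_iSup_of_le hxc le_rfl)))
      exact le_self_add
    rw [← ofReal_norm] at h1
    exact (ENNReal.ofReal_le_ofReal_iff (hg0 x)).1 h1
  have hh' : ∀ᵐ x ∂P, ∀ θ ∈ K, ∀ G ∈ marginNhd γ δ F, applyMargins G x ∈ openCube d p → ∀ k j,
      ‖weight γ (F j (x k j)) •
        fderiv ℝ (M.score Θ θ) (applyMargins G x) (Pi.single k (Pi.single j 1))‖ ≤ h k j x := by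
    filter_upwards [ae_all_iff.2 fun k => ae_all_iff.2 fun j => hh k j] with x hx θ hθ G hG hGx k j
    have h1 := le_trans (le_iSup₂_of_le θ hθ (le_iSup₂_of_le G hG (le_iSup_of_le hGx le_rfl)))
      (hx k j)
    rw [← ofReal_norm] at h1
    exact (ENNReal.ofReal_le_ofReal_iff (hh0 k j x)).1 h1
  -- the uniform law of large numbers on `K`
  obtain ⟨G, hGi, hG⟩ := exists_integrable_continuousMap (K := K) (f := fun θ u => M.score Θ θ u)
    (v := applyMargins F) isOpen_openCube.measurableSet
    (hSP2.contDiff.continuousOn.mono (Set.prod_mono_left hKΘ))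
    (measurable_pi_lambda _ fun k => measurable_pi_lambda _ fun j =>
      (hcont j).measurable.comp (by fun_prop)) hcube hgi hg0 hg'
  have hmean : ∀ θ (hθ : θ ∈ K), meanScore M Θ P F θ = (∫ x, G x ∂P) ⟨θ, hθ⟩ := by
    intro θ hθ
    rw [← ContinuousMap.evalCLM_apply ℝ, ← ContinuousLinearMap.integral_comp_comm _ hGi]
    refine integral_congr_ae ?_
    filter_upwards [hcube] with x hx
    exact (hG x hx ⟨θ, hθ⟩).symm
  have hdiff : ∀ θ ∈ Θ, DifferentiableOn ℝ (fun u => M.score Θ θ u) (openCube d p) := by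
    intro θ hθ
    exact (hSP2.contDiff.differentiableOn one_ne_zero).comp (f := fun u => (θ, u)) (by fun_prop)
      fun u hu => ⟨hθ, hu⟩
  set H : (Fin (p + 1) → Fin d → ℝ) → ℝ := fun x => ∑ k, ∑ j, h k j x
  have hH0 : ∀ x, 0 ≤ H x := fun x =>
    Finset.sum_nonneg fun k _ => Finset.sum_nonneg fun j _ => hh0 k j x
  have hHi : Integrable H P :=
    integrable_finsetSum _ fun k _ => integrable_finsetSum _ fun j _ => hhi k j
  -- `δ'` is so small that `δ'` times the sample mean of `H` is below `c / 2` with high probability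
  obtain ⟨δ', hδ'0, hδ'δ, hδ'η⟩ : ∃ δ' : ℝ, 0 < δ' ∧ δ' ≤ δ ∧ (∫ x, H x ∂P) / (c / (2 * δ')) ≤ η := by
    have hI : 0 ≤ ∫ x, H x ∂P := integral_nonneg hH0
    refine ⟨min δ (η * c / (2 * (∫ x, H x ∂P + 1))), by positivity, min_le_left _ _, ?_⟩
    set δ' := min δ (η * c / (2 * (∫ x, H x ∂P + 1)))
    have hpos : 0 < δ' := by positivity
    have hle : δ' ≤ η * c / (2 * (∫ x, H x ∂P + 1)) := min_le_right _ _
    rw [le_div_iff₀ (by positivity)] at hle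
    rw [div_le_iff₀ (by positivity), mul_div_assoc', le_div_iff₀ (by positivity)]
    nlinarith
  -- the properties which almost surely all of the windows have
  let Q : (Fin (p + 1) → Fin d → ℝ) → Prop := fun x => applyMargins F x ∈ openCube d p ∧
    ∀ θ ∈ K, ∀ G ∈ marginNhd γ δ F, applyMargins G x ∈ openCube d p → ∀ k j,
      ‖weight γ (F j (x k j)) •
        fderiv ℝ (M.score Θ θ) (applyMargins G x) (Pi.single k (Pi.single j 1))‖ ≤ h k j x
  have hQ : ∀ᵐ ω ∂μ, ∀ t : ℕ, Q (dataWindow p X (t + 1) ω) := by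
    refine ae_all_iff.2 fun t => ?_
    have hQP : ∀ᵐ x ∂P, Q x := hcube.and hh'
    rw [hP, ← hW.map_eq t] at hQP
    exact ae_of_ae_map (hW.measurable t).aemeasurable hQP
  filter_upwards [hKη, hsolve'.eventually (gt_mem_nhds hη), eventually_gt_atTop 0,
    (tendsto_measureReal_empMargin hX hstat hreg hcont p hγ₀ hγ₁ hδ'0).eventually (gt_mem_nhds hη),
    (hW.tendsto_measureReal_le_norm_meanDev hGi (half_pos hc)).eventually (gt_mem_nhds hη)]
    with T m₁ m₂ hT m₃ m₄
  rw [Real.dist_eq, sub_zero, abs_of_nonneg measureReal_nonneg]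
  have m₁' : μ.real {ω | θhat T ω ∉ K} ≤ η := by
    refine ENNReal.toReal_le_of_le_ofReal hη.le m₁
  have m₅ := (hW.measureReal_le_sampleMean_le hH0 hHi (ε := c / (2 * δ')) (by positivity) T).trans
    hδ'η
  -- exceptional events: the null set, an estimate outside of `K` or not solving the equation, empirical
  -- margins far from the true ones, a large deviation in the uniform law of large numbers, and a large
  -- sample mean of the majorant `H`
  set E₀ : Set Ω := {ω | ¬ ∀ t : ℕ, Q (dataWindow p X (t + 1) ω)}
  have m₀ : μ.real E₀ = 0 := by
    rw [Measure.real, ae_iff.1 hQ, ENNReal.toReal_zero]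
  set E₁ : Set Ω := {ω | θhat T ω ∉ K}
  set E₂ : Set Ω := {ω | ¬ SolvesEstimatingEq p M Θ X T ω (θhat T ω)}
  set E₃ : Set Ω := {ω | ¬ ∀ t < T,
      applyMargins (empMargin X T ω) (dataWindow p X (t + 1) ω) ∈ openCube d p ∧
      ∀ k j, |empMargin X T ω j (dataWindow p X (t + 1) ω k j)
        - F j (dataWindow p X (t + 1) ω k j)|
          ≤ δ' * weight γ (F j (dataWindow p X (t + 1) ω k j))}
  set E₄ : Set Ω := {ω | c / 2 ≤ ‖meanDev (fun t : ℕ => dataWindow p X (t + 1)) P G T ω‖}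
  set E₅ : Set Ω := {ω | c / (2 * δ') ≤
    (T : ℝ)⁻¹ * ∑ t ∈ Finset.range T, H (dataWindow p X (t + 1) ω)}
  refine lt_of_le_of_lt (b := μ.real (E₀ ∪ (E₁ ∪ (E₂ ∪ (E₃ ∪ (E₄ ∪ E₅)))))) (measureReal_mono ?_) ?_
  swap
  · have u1 := measureReal_union_le (μ := μ) E₀ (E₁ ∪ (E₂ ∪ (E₃ ∪ (E₄ ∪ E₅))))
    have u2 := measureReal_union_le (μ := μ) E₁ (E₂ ∪ (E₃ ∪ (E₄ ∪ E₅)))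
    have u3 := measureReal_union_le (μ := μ) E₂ (E₃ ∪ (E₄ ∪ E₅))
    have u4 := measureReal_union_le (μ := μ) E₃ (E₄ ∪ E₅)
    have u5 := measureReal_union_le (μ := μ) E₄ E₅
    linarith
  intro ω hbad
  by_contra hω
  simp only [Set.mem_union, not_or] at hω
  obtain ⟨g0, g1, g2, g3, g4, g5⟩ := hω
  replace g0 := not_not.1 g0
  replace g1 : θhat T ω ∈ K := not_not.1 g1
  replace g2 := not_not.1 g2
  replace g3 := not_not.1 g3
  replace g4 := not_le.1 (show ¬ c / 2 ≤ _ from g4)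
  replace g5 := not_le.1 (show ¬ c / (2 * δ') ≤ _ from g5)
  obtain ⟨hmem, hsol⟩ := g2
  replace hbad : ε ≤ ‖θhat T ω - θs‖ := hbad
  generalize θhat T ω = θ at *
  have hT' : (0 : ℝ) < T := by exact_mod_cast hT
  rw [sum_Icc_one_eq_sum_range, one_div] at hsol
  have hdev : ‖(T : ℝ)⁻¹ • ∑ t ∈ Finset.range T,
      M.score Θ θ (applyMargins F (dataWindow p X (t + 1) ω)) - meanScore M Θ P F θ‖ < c / 2 := by
    refine lt_of_le_of_lt ?_ g4
    refine le_trans (le_of_eq ?_) (ContinuousMap.norm_coe_le_norm _ ⟨θ, g1⟩)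
    rw [hmean θ g1, meanDev]
    simp only [ContinuousMap.sub_apply, ContinuousMap.smul_apply, ContinuousMap.sum_apply]
    congr 3
    exact Finset.sum_congr rfl fun t _ => (hG _ (g0 t).1 ⟨θ, g1⟩).symm
  have hpert : ‖(T : ℝ)⁻¹ • ∑ t ∈ Finset.range T,
      M.score Θ θ (applyMargins F (dataWindow p X (t + 1) ω))‖ < c / 2 := by
    calc ‖(T : ℝ)⁻¹ • ∑ t ∈ Finset.range T,
            M.score Θ θ (applyMargins F (dataWindow p X (t + 1) ω))‖
        = ‖(T : ℝ)⁻¹ • ∑ t ∈ Finset.range T,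
            (M.score Θ θ (applyMargins (empMargin X T ω) (dataWindow p X (t + 1) ω))
              - M.score Θ θ (applyMargins F (dataWindow p X (t + 1) ω)))‖ := by
          rw [Finset.sum_sub_distrib, smul_sub, hsol, zero_sub, norm_neg]
      _ ≤ (T : ℝ)⁻¹ * ∑ t ∈ Finset.range T, δ' * H (dataWindow p X (t + 1) ω) := by
          rw [norm_smul, Real.norm_of_nonneg (by positivity)]
          gcongr
          refine norm_sum_le_of_le _ fun t ht => ?_
          have ht := Finset.mem_range.1 ht
          exact norm_sub_le_of_margins (hdiff θ hmem) hFmem (g0 t).1 (g3 t ht).1 hδ'0.le hδ'δ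
            (g3 t ht).2 ((g0 t).2 θ g1)
      _ = δ' * ((T : ℝ)⁻¹ * ∑ t ∈ Finset.range T, H (dataWindow p X (t + 1) ω)) := by
          rw [← Finset.mul_sum]; ring
      _ < δ' * (c / (2 * δ')) := by gcongr
      _ = c / 2 := by field_simp
  have hsmall : ‖meanScore M Θ P F θ‖ < c := by
    have := norm_sub_le ((T : ℝ)⁻¹ • ∑ t ∈ Finset.range T,
      M.score Θ θ (applyMargins F (dataWindow p X (t + 1) ω)))
      ((T : ℝ)⁻¹ • ∑ t ∈ Finset.range T,
      M.score Θ θ (applyMargins F (dataWindow p X (t + 1) ω)) - meanScore M Θ P F θ)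
    rw [sub_sub_cancel] at this
    linarith
  exact absurd (hsep θ hmem (lt_of_lt_of_le (half_lt_self hε) hbad)) (not_le.2 hsmall)
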